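/- **Setting.** Let $\mathbb{K}$ be a field of characteristic $0$ with a topology, $X$ a topological space, and $\mathcal{O}_X$ a sheaf of $\mathbb{K}$-subalgebras of the sheaf of continuous $\mathbb{K}$-valued functions on $X$ (for example the sheaf of smooth, holomorphic or regular functions). Put $\mathcal{T}_X=\mathcal{D}er_{\mathbb{K}}(\mathcal{O}_X)$, $\Omega^1_X=\mathcal{H}om_{\mathcal{O}_X}(\mathcal{T}_X,\mathcal{O}_X)$ and $d_X:\mathcal{O}_X\to\Omega^1_X$, $d_Xf(D)=D(f)$. A *Lie algebroid* is an $\mathcal{O}_X$-module $\mathcal{E}$ with the structure $[\cdot,\cdot]_{\mathcal{E}}$ of a sheaf of $\mathbb{K}$-Lie algebras and an $\mathcal{O}_X$-linear map $\mathfrak{a}_{\mathcal{E}}:\mathcal{E}\to\mathcal{T}_X$ (the anchor) that preserves brackets and satisfies $[D,fD']_{\mathcal{E}}=f[D,D']_{\mathcal{E}}+\mathfrak{a}_{\mathcal{E}}(D)(f)\,D'$. A homomorphism of Lie algebroids is an $\mathcal{O}_X$-linear map that preserves brackets and commutes with the anchors. For a Lie algebroid $\mathcal{L}$, an *$\mathcal{L}$-Lie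 algebroid structure* on an $\mathcal{O}_X$-module $\mathcal{E}$ is a Lie algebroid structure on $\mathcal{E}$ for which there is a homomorphism of Lie algebroids $\phi:\mathcal{E}\to\mathcal{L}$. For an $\mathcal{O}_X$-module $\mathcal{E}$ let $\Omega^k_{\mathcal{E}}=\mathcal{H}om_{\mathcal{O}_X}(\wedge^k_{\mathcal{O}_X}\mathcal{E},\mathcal{O}_X)$, with the wedge product of alternating forms (sum over shuffles), and $\mathcal{E}^*=\Omega^1_{\mathcal{E}}$. For a Lie algebroid $\mathcal{E}$, the Chevalley–Eilenberg–de Rham differential $d$ on $\Omega^\bullet_{\mathcal{E}}$ is $$d\omega(s_1,\dots,s_{k+1})=\sum_{i}(-1)^{i+1}\mathfrak{a}_{\mathcal{E}}(s_i)\big(\omega(s_1,\dots,\widehat{s_i},\dots,s_{k+1})\big)+\sum_{i<j}(-1)^{i+j}\omega([s_i,s_j]_{\mathcal{E}},s_1,\dots,\widehat{s_i},\dots,\widehat{s_j},\dots,s_{k+1}).$$ Let $\mathcal{L}$ be a Lie algebroid that is locally free of finite rank as an $\mathcal{O}_X$-module, $d_{\mathcal{L}}$ its Chevalley–Eilenberg–de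 Rham differential, and let $\mathcal{E}$ be a locally free $\mathcal{O}_X$-module of finite rank (the rank may vary from point to point). An *$\Omega^\bullet_{\mathcal{L}}$-differential graded algebra structure* on $\wedge^\bullet_{\mathcal{O}_X}\mathcal{E}^*$ is a pair $(d,\psi)$, where * $d$ is a $\mathbb{K}$-linear differential of degree $1$ on the sheaf $\wedge^\bullet_{\mathcal{O}_X}\mathcal{E}^*$, i.e. $d^2=0$ and $d(\omega\wedge\eta)=d\omega\wedge\eta+(-1)^{k}\omega\wedge d\eta$ for $\omega$ of degree $k$; * $\psi:(\Omega^\bullet_{\mathcal{L}},d_{\mathcal{L}})\to(\wedge^\bullet_{\mathcal{O}_X}\mathcal{E}^*,d)$ is an $\mathcal{O}_X$-linear homomorphism of sheaves of differential graded algebras; * in degree $0$, $d$ is the composition $\mathcal{O}_X\xrightarrow{d_X}\Omega^1_X\xrightarrow{\mathfrak{a}_{\mathcal{L}}^*}\Omega^1_{\mathcal{L}}\xrightarrow{\psi_1}\mathcal{E}^*$. **Theorem.** 1. The maps $\alpha_1\wedge\dots\wedge\alpha_k\mapsto\big((v_1,\dots,v_k)\mapsto\det(\alpha_j(v_i))\big)$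 identify the sheaf of graded algebras $\wedge^\bullet_{\mathcal{O}_X}\mathcal{E}^*$ with $\Omega^\bullet_{\mathcal{E}}$: they are multiplicative, and every point of $X$ has, for each $k$, a neighbourhood $U$ such that $\wedge^k_{\mathcal{O}_X(V)}\mathcal{E}^*(V)\to\Omega^k_{\mathcal{E}}(V)$ is bijective for all open $V\subseteq U$. This identification is used in what follows. 2. $\mathcal{E}$ has an $\mathcal{L}$-Lie algebroid structure if and only if $\wedge^\bullet_{\mathcal{O}_X}\mathcal{E}^*$ has an $\Omega^\bullet_{\mathcal{L}}$-differential graded algebra structure. 3. More precisely, let $d:\wedge^\bullet_{\mathcal{O}_X}\mathcal{E}^*\to\wedge^{\bullet+1}_{\mathcal{O}_X}\mathcal{E}^*$ be a $\mathbb{K}$-linear map of graded sheaves and $\psi:\Omega^\bullet_{\mathcal{L}}\to\wedge^\bullet_{\mathcal{O}_X}\mathcal{E}^*$ an $\mathcal{O}_X$-linear map of graded sheaves. Then $(d,\psi)$ is an $\Omega^\bullet_{\mathcal{L}}$-differential graded algebra structure on $\wedge^\bullet_{\mathcal{O}_X}\mathcal{E}^*$ if and only if there are a Lie algebroid structure on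 $\mathcal{E}$ and a homomorphism of Lie algebroids $\phi:\mathcal{E}\to\mathcal{L}$ such that $d$ is the Chevalley–Eilenberg–de Rham differential $d_{\mathcal{E}}$ of this structure and $\psi=\phi^*$ is the pull-back of forms along $\phi$. -/

import Mathlib

open CategoryTheory TopologicalSpace Opposite

universe u

noncomputable section

namespace LieRinehart

variable {K A M : Type*} [Field K] [CommRing A] [Algebra K A] [AddCommGroup M] [Module A M]
  [Module K M]

/-- The terms of the Chevalley–Eilenberg differential of a `k`-form `ω` that involve the
bracket `b`: the sum, over all pairs of positions `p < q` in `(v₀, …, v_k)`, of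
`(-1)^(p+q) ω([v_p, v_q], v₀, …, v̂_p, …, v̂_q, …, v_k)`.  The pairs `p < q` are written
`p = i.castSucc`, `q = j.succ` with `i ≤ j`.  -/
def bracketTerms (b : M →ₗ[K] M →ₗ[K] M) :
    ∀ {k : ℕ}, (M [⋀^Fin k]→ₗ[A] A) → (Fin (k + 1) → M) → A
  | 0, _, _ => 0
  | k + 1, ω, v => ∑ i : Fin (k + 1), ∑ j ∈ Finset.Ici i, (-1 : ℤ) ^ ((i : ℕ) + (j + 1)) •
      ω (Matrix.vecCons (b (v i.castSucc) (v j.succ))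
        (j.removeNth (i.castSucc.removeNth v)))

/-- The Chevalley–Eilenberg formula
`∑ᵢ (-1)^i a(vᵢ)(ω(v₀, …, v̂ᵢ, …, v_k))
  + ∑_{i<j} (-1)^(i+j) ω([vᵢ, vⱼ], v₀, …, v̂ᵢ, …, v̂ⱼ, …, v_k)`
(positions numbered from `0`) for a bracket `b` and an anchor `a`. -/
def ceFormula (b : M →ₗ[K] M →ₗ[K] M) (a : M →ₗ[A] Derivation K A A) {k : ℕ}
    (ω : M [⋀^Fin k]→ₗ[A] A) (v : Fin (k + 1) → M) : A :=
  ∑ i : Fin (k + 1), (-1 : ℤ) ^ (i : ℕ) • a (v i) (ω (i.removeNth v)) + bracketTerms b ω v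

theorem removeNth_succ_vecCons {N : Type*} {n : ℕ} (y : N) (w : Fin (n + 1) → N) (j : Fin (n + 1)) :
    j.succ.removeNth (Matrix.vecCons y w : Fin (n + 2) → N) = Matrix.vecCons y (j.removeNth w) := by
  ext t
  refine Fin.cases ?_ (fun t => ?_) t
  · simp [Fin.removeNth]
  · simp [Fin.removeNth]

theorem ceFormula_cons_smul (b : M →ₗ[K] M →ₗ[K] M) (hb : ∀ x, b x x = 0)
    (a : M →ₗ[A] Derivation K A A) (hL : ∀ x f y, b x (f • y) = f • b x y + a x f • y) {k : ℕ}
    (ω : M [⋀^Fin k]→ₗ[A] A) (f : A) (x : M) (w : Fin k → M) :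
    ceFormula b a ω (Matrix.vecCons (f • x) w) = f • ceFormula b a ω (Matrix.vecCons x w) := by
  have hb' : ∀ x y, b y x = - b x y := fun x y => by
    have h := hb (x + y)
    simp only [map_add, LinearMap.add_apply, hb, zero_add, add_zero] at h
    exact eq_neg_of_add_eq_zero_left h
  have hL' : ∀ x f y, b (f • x) y = f • b x y - a y f • x := fun x f y => by
    rw [hb' y, hL, hb' x y]; simp; abel
  cases k with
  | zero => simp [ceFormula, bracketTerms]
  | succ k =>
    have key : ∀ y : M, ceFormula b a ω (Matrix.vecCons y w) = a y (ω w) +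
        ∑ j : Fin (k + 1), (-1 : ℤ) ^ ((j : ℕ) + 1) •
          (a (w j) (ω (Matrix.vecCons y (j.removeNth w))) +
            ω (Matrix.vecCons (b y (w j)) (j.removeNth w))) +
        ∑ i : Fin k, ∑ j ∈ Finset.Ici i.succ, (-1 : ℤ) ^ ((i.succ : ℕ) + (j + 1)) •
          ω (Matrix.vecCons (b (w i.castSucc) (w j))
            (j.removeNth (i.castSucc.succ.removeNth (Matrix.vecCons y w)))) := by
      intro y
      have h0 : Finset.Ici (0 : Fin (k + 1)) = Finset.univ := by ext; simp
      rw [ceFormula, bracketTerms, Fin.sum_univ_succ (n := k + 1)]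
      conv_lhs => arg 2; rw [Fin.sum_univ_succ, h0]
      simp only [smul_add, Finset.sum_add_distrib, removeNth_succ_vecCons, Fin.val_succ,
        Fin.val_zero, pow_zero, one_smul, zero_add, Matrix.cons_val_succ,
        Matrix.cons_val_zero, Fin.castSucc_zero, ← Fin.succ_castSucc]
      have h1 : (0 : Fin (k + 2)).removeNth (Matrix.vecCons y w : Fin (k + 2) → M) = w := by
        ext t; simp [Fin.removeNth]
      rw [h1]
      abel
    rw [key, key, smul_add, smul_add, Finset.smul_sum, Finset.smul_sum]
    congr 1
    · congr 1
      · simp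
      · refine Finset.sum_congr rfl fun j _ => ?_
        rw [hL', sub_eq_add_neg, AlternatingMap.map_vecCons_add, AlternatingMap.map_vecCons_smul,
          AlternatingMap.map_vecCons_smul, ← neg_smul, AlternatingMap.map_vecCons_smul,
          smul_comm f, smul_eq_mul, Derivation.leibniz]
        congr 1
        simp only [smul_eq_mul]
        ring
    · refine Finset.sum_congr rfl fun i _ => ?_
      rw [Finset.smul_sum]
      refine Finset.sum_congr rfl fun j hj => ?_
      rw [Finset.mem_Ici] at hj
      obtain ⟨j, rfl⟩ := Fin.exists_succ_eq.2 (ne_of_gt (lt_of_lt_of_le (Fin.succ_pos i) hj))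
      obtain ⟨k, rfl⟩ : ∃ k', k = k' + 1 := ⟨k - 1, by have := i.2; omega⟩
      rw [removeNth_succ_vecCons, removeNth_succ_vecCons, removeNth_succ_vecCons,
        removeNth_succ_vecCons, smul_comm f]
      congr 1
      exact (ω.curryLeft (b (w i.castSucc) (w j.succ))).map_vecCons_smul _ f x

theorem ceFormula_add (b : M →ₗ[K] M →ₗ[K] M) (a : M →ₗ[A] Derivation K A A) {k : ℕ}
    (ω η : M [⋀^Fin k]→ₗ[A] A) (v : Fin (k + 1) → M) :
    ceFormula b a (ω + η) v = ceFormula b a ω v + ceFormula b a η v := by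
  cases k <;> simp [ceFormula, bracketTerms, Finset.sum_add_distrib] <;> abel

theorem ceFormula_smul (b : M →ₗ[K] M →ₗ[K] M) (a : M →ₗ[A] Derivation K A A) {k : ℕ}
    (r : K) (ω : M [⋀^Fin k]→ₗ[A] A) (v : Fin (k + 1) → M) :
    ceFormula b a (r • ω) v = r • ceFormula b a ω v := by
  cases k <;> simp [ceFormula, bracketTerms, Finset.smul_sum]

theorem map_ceFormula {B N : Type*} [CommRing B] [Algebra K B] [AddCommGroup N] [Module B N]
    [Module K N] (f : A →+* B) (g : M → N) (b : M →ₗ[K] M →ₗ[K] M)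
    (b' : N →ₗ[K] N →ₗ[K] N) (a : M →ₗ[A] Derivation K A A) (a' : N →ₗ[B] Derivation K B B)
    (hb : ∀ x y, g (b x y) = b' (g x) (g y)) (ha : ∀ x z, f (a x z) = a' (g x) (f z)) {k : ℕ}
    (ω : M [⋀^Fin k]→ₗ[A] A) (ω' : N [⋀^Fin k]→ₗ[B] B)
    (hω : ∀ v, f (ω v) = ω' fun i => g (v i)) (v : Fin (k + 1) → M) :
    f (ceFormula b a ω v) = ceFormula b' a' ω' fun i => g (v i) := by
  have h1 : f (bracketTerms b ω v) = bracketTerms b' ω' fun i => g (v i) := by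
    cases k with
    | zero => exact map_zero f
    | succ k =>
      simp only [bracketTerms, map_sum, map_zsmul, hω]
      refine Finset.sum_congr rfl fun i _ => Finset.sum_congr rfl fun j _ => ?_
      congr 2
      funext t
      refine Fin.cases ?_ (fun t => ?_) t
      · exact hb _ _
      · rfl
  rw [ceFormula, ceFormula, map_add, h1, map_sum]
  congr 1
  refine Finset.sum_congr rfl fun i _ => ?_
  rw [map_zsmul, ha, hω]
  rfl

variable [IsScalarTower K A M]

/-- Restriction of scalars of an alternating map, from `A` to `K`. -/
def restrictAlt {k : ℕ} (ω : M [⋀^Fin k]→ₗ[A] A) : M [⋀^Fin k]→ₗ[K] A :=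
  { ω.toMultilinearMap.restrictScalars K with
    map_eq_zero_of_eq' := ω.map_eq_zero_of_eq' }

theorem restrictAlt_apply {k : ℕ} (ω : M [⋀^Fin k]→ₗ[A] A) (v : Fin k → M) :
    restrictAlt (K := K) ω v = ω v := rfl

theorem exists_bracketTerms [CharZero K] (b : M →ₗ[K] M →ₗ[K] M) (hb : ∀ x, b x x = 0) {k : ℕ}
    (ω : M [⋀^Fin k]→ₗ[A] A) :
    ∃ G : M [⋀^Fin (k + 1)]→ₗ[K] A, ∀ v, G v = bracketTerms b ω v := by
  cases k with
  | zero => exact ⟨0, fun _ => rfl⟩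
  | succ k =>
    have hb' : ∀ x y, b y x = - b x y := fun x y => by
      have h := hb (x + y)
      simp only [map_add, LinearMap.add_apply, hb, zero_add, add_zero] at h
      exact eq_neg_of_add_eq_zero_left h
    let c : M →ₗ[K] M →ₗ[K] M [⋀^Fin k]→ₗ[K] A :=
      b.compr₂ (restrictAlt (K := K) ω).curryLeft
    refine ⟨-((2 : K)⁻¹ • AlternatingMap.alternatizeUncurryFin
      (AlternatingMap.alternatizeUncurryFinLM ∘ₗ c)), fun v => ?_⟩
    rw [AlternatingMap.neg_apply, AlternatingMap.smul_apply,
      AlternatingMap.alternatizeUncurryFin_alternatizeUncurryFinLM_comp_apply, bracketTerms,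
      Finset.smul_sum, ← Finset.sum_neg_distrib]
    refine Finset.sum_congr rfl fun i _ => ?_
    rw [Finset.smul_sum, ← Finset.sum_neg_distrib]
    refine Finset.sum_congr rfl fun j _ => ?_
    have h1 : ∀ x y, c x y = (restrictAlt (K := K) ω).curryLeft (b x y) := fun _ _ => rfl
    rw [h1, h1, hb' (v i.castSucc), map_neg, AlternatingMap.neg_apply, sub_neg_eq_add,
      AlternatingMap.curryLeft_apply_apply, restrictAlt_apply, ← two_smul K,
      smul_comm ((-1 : ℤ) ^ _), smul_smul, inv_mul_cancel₀ two_ne_zero, one_smul, ← add_assoc,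
      pow_succ, mul_neg_one, neg_smul]

theorem exists_ceFormula [CharZero K] (b : M →ₗ[K] M →ₗ[K] M) (hb : ∀ x, b x x = 0)
    (a : M →ₗ[A] Derivation K A A) {k : ℕ} (ω : M [⋀^Fin k]→ₗ[A] A) :
    ∃ G : M [⋀^Fin (k + 1)]→ₗ[K] A, ∀ v, G v = ceFormula b a ω v := by
  obtain ⟨G, hG⟩ := exists_bracketTerms b hb ω
  let c : M →ₗ[K] M [⋀^Fin k]→ₗ[K] A :=
    { toFun := fun x => (a x : A →ₗ[K] A).compAlternatingMap (restrictAlt (K := K) ω)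
      map_add' := fun x y => by ext v; simp
      map_smul' := fun r x => by
        ext v
        change a (r • x) (ω v) = r • a x (ω v)
        rw [← algebraMap_smul A r x, map_smul, Derivation.smul_apply, algebraMap_smul] }
  refine ⟨AlternatingMap.alternatizeUncurryFin c + G, fun v => ?_⟩
  rw [AlternatingMap.add_apply, AlternatingMap.alternatizeUncurryFin_apply, hG, ceFormula]
  rfl

/-- The Chevalley–Eilenberg differential of an `A`-multilinear alternating form `ω`, given by
`ceFormula`. -/
def ceDiff [CharZero K] (b : M →ₗ[K] M →ₗ[K] M) (hb : ∀ x, b x x = 0)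
    (a : M →ₗ[A] Derivation K A A) (hL : ∀ x f y, b x (f • y) = f • b x y + a x f • y) {k : ℕ}
    (ω : M [⋀^Fin k]→ₗ[A] A) : M [⋀^Fin (k + 1)]→ₗ[A] A where
  toFun := ceFormula b a ω
  map_update_add' v i x y := by
    obtain ⟨G, hG⟩ := exists_ceFormula b hb a ω
    rw [← hG, ← hG, ← hG]
    convert G.map_update_add v i x y
  map_update_smul' {inst} v i f x := by
    obtain rfl : inst = instDecidableEqFin _ := Subsingleton.elim _ _
    obtain ⟨G, hG⟩ := exists_ceFormula b hb a ω
    have h : ∀ z, ceFormula b a ω (Function.update v i z) =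
        (-1 : ℤ) ^ (i : ℕ) • ceFormula b a ω (Matrix.vecCons z (i.removeNth v)) := fun z => by
      rw [← hG, ← hG, ← AlternatingMap.map_insertNth]
      congr 1
      exact (Fin.insertNth_removeNth i z v).symm
    rw [h, h, ceFormula_cons_smul b hb a hL, smul_comm]
  map_eq_zero_of_eq' v i j hv hij := by
    obtain ⟨G, hG⟩ := exists_ceFormula b hb a ω
    change ceFormula b a ω v = 0
    rw [← hG]
    exact G.map_eq_zero_of_eq v hv hij

theorem ceDiff_apply [CharZero K] (b : M →ₗ[K] M →ₗ[K] M) (hb : ∀ x, b x x = 0)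
    (a : M →ₗ[A] Derivation K A A) (hL : ∀ x f y, b x (f • y) = f • b x y + a x f • y) {k : ℕ}
    (ω : M [⋀^Fin k]→ₗ[A] A) (v : Fin (k + 1) → M) :
    ceDiff b hb a hL ω v = ceFormula b a ω v := rfl

/-- Base change compatibility of the coproduct of two scalar valued alternating maps. -/
theorem map_mul'_domCoprod {A B M N ι κ : Type*} [CommRing A] [CommRing B]
    [AddCommGroup M] [AddCommGroup N] [Module A M] [Module B N] [Fintype ι] [Fintype κ] [DecidableEq ι] [DecidableEq κ]
    (f : A →+* B) (g : M → N)
    (a : M [⋀^ι]→ₗ[A] A) (b : M [⋀^κ]→ₗ[A] A) (a' : N [⋀^ι]→ₗ[B] B) (b' : N [⋀^κ]→ₗ[B] B)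
    (ha : ∀ v, f (a v) = a' fun i => g (v i)) (hb : ∀ v, f (b v) = b' fun i => g (v i))
    (v : ι ⊕ κ → M) :
    f (LinearMap.mul' A A (a.domCoprod b v)) =
      LinearMap.mul' B B (a'.domCoprod b' fun i => g (v i)) := by
  rw [AlternatingMap.domCoprod_apply, AlternatingMap.domCoprod_apply, sum_apply,
    sum_apply, map_sum, map_sum, map_sum]
  refine Finset.sum_congr rfl fun σ _ => ?_
  induction σ using Quotient.inductionOn' with | _ σ => ?_
  rw [AlternatingMap.domCoprod.summand_mk'', AlternatingMap.domCoprod.summand_mk'']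
  rcases Int.units_eq_one_or (Equiv.Perm.sign σ) with h | h
  · rw [h, one_smul, one_smul]
    simp [ha, hb]
  · rw [h, Units.neg_smul, one_smul, Units.neg_smul, one_smul]
    simp [ha, hb]

/-- The form `v ↦ det (αⱼ(vᵢ))` attached to linear forms `α₁, …, α_k`. -/
def detForm {A M : Type*} [CommRing A] [AddCommGroup M] [Module A M] {k : ℕ}
    (α : Fin k → M →ₗ[A] A) : M [⋀^Fin k]→ₗ[A] A :=
  Matrix.detRowAlternating.compLinearMap (LinearMap.pi α)

theorem detForm_apply {A M : Type*} [CommRing A] [AddCommGroup M] [Module A M] {k : ℕ}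
    (α : Fin k → M →ₗ[A] A) (v : Fin k → M) :
    detForm α v = (Matrix.of fun i j => α j (v i)).det := rfl

end LieRinehart

/-- A topological ringed space over `K` with underlying space `X`: a sheaf `O` of `K`-subalgebras
of the sheaf of continuous `K`-valued functions on `X`. -/
structure TopRingedSpace (K : Type u) [Field K] [TopologicalSpace K] (X : TopCat.{u}) where
  /-- The algebra of sections over an open set. -/
  sec (U : Opens X) : Subalgebra K (U → K)
  /-- Sections are continuous functions. -/
  continuous_of_mem {U : Opens X} {f : U → K} : f ∈ sec U → Continuous f
  /-- Sections are stable under restriction. -/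
  res_mem {U V : Opens X} (h : V ≤ U) {f : U → K} :
    f ∈ sec U → (fun x : V => f ⟨x, h x.2⟩) ∈ sec V
  /-- A function that is locally a section is a section. -/
  mem_of_locally {U : Opens X} {f : U → K} :
    (∀ x : U, ∃ V : Opens X, ∃ h : V ≤ U, (x : X) ∈ V ∧ (fun y : V => f ⟨y, h y.2⟩) ∈ sec V) →
      f ∈ sec U

namespace TopRingedSpace

variable {K : Type u} [Field K] [TopologicalSpace K] {X : TopCat.{u}} (O : TopRingedSpace K X)

/-- Restriction of functions, `O(U) → O(V)` for `V ⊆ U`. -/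
def res {U V : Opens X} (h : V ≤ U) : O.sec U →ₐ[K] O.sec V where
  toFun f := ⟨fun x => f.1 ⟨x, h x.2⟩, O.res_mem h f.2⟩
  map_one' := rfl
  map_mul' _ _ := rfl
  map_zero' := rfl
  map_add' _ _ := rfl
  commutes' _ := rfl

/-- The structure sheaf as a presheaf of rings. -/
def ringPresheaf : TopCat.Presheaf RingCat.{u} X where
  obj U := RingCat.of (O.sec U.unop)
  map f := RingCat.ofHom (O.res (leOfHom f.unop)).toRingHom
  map_id _ := rfl
  map_comp _ _ := rfl

theorem ringPresheaf_isSheaf : O.ringPresheaf.IsSheaf := by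
  rw [TopCat.Presheaf.isSheaf_iff_isSheafUniqueGluing]
  intro ι U sf hsf
  have hsf' : ∀ (i j : ι) (x : X) (hi : x ∈ U i) (hj : x ∈ U j),
      (sf i : O.sec (U i)).1 ⟨x, hi⟩ = (sf j : O.sec (U j)).1 ⟨x, hj⟩ := fun i j x hi hj =>
    congrFun (congrArg (Subtype.val : O.sec (U i ⊓ U j) → _) (hsf i j)) ⟨x, hi, hj⟩
  have hmem : ∀ x : ↥(iSup U), ∃ i, (x : X) ∈ U i := fun x => Opens.mem_iSup.1 x.2
  choose c hc using hmem
  let f : ↥(iSup U) → K := fun x => (sf (c x) : O.sec (U (c x))).1 ⟨x, hc x⟩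
  have hf : ∀ i, (fun y : U i => f ⟨y, le_iSup U i y.2⟩) = (sf i : O.sec (U i)).1 := fun i => by
    funext y
    exact hsf' _ _ _ _ _
  refine ⟨(⟨f, O.mem_of_locally fun x => ⟨U (c x), le_iSup U _, hc x, ?_⟩⟩ :
    O.sec (iSup U)), fun i => Subtype.ext (hf i), fun g hg => Subtype.ext ?_⟩
  · rw [hf]; exact (sf (c x) : O.sec (U (c x))).2
  · funext x
    exact congrFun (congrArg (Subtype.val : O.sec (U (c x)) → _) (hg (c x))) ⟨x, hc x⟩

/-- The structure sheaf as a sheaf of rings. -/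
def ringSheaf : Sheaf (Opens.grothendieckTopology X) RingCat.{u} := ⟨O.ringPresheaf, O.ringPresheaf_isSheaf⟩

/-- Sheaves of `O`-modules. -/
abbrev Mod : Type (u + 1) := SheafOfModules.{u} O.ringSheaf

variable {O}

/-- The sections of an `O`-module over an open set. -/
def Sec (E : Mod O) (U : Opens X) : Type u := E.val.obj (op U)

instance (E : Mod O) (U : Opens X) : AddCommGroup (Sec E U) :=
  inferInstanceAs (AddCommGroup (E.val.obj (op U)))

instance (E : Mod O) (U : Opens X) : Module (O.sec U) (Sec E U) :=
  inferInstanceAs (Module (O.ringSheaf.obj.obj (op U)) (E.val.obj (op U)))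

instance (E : Mod O) (U : Opens X) : Module K (Sec E U) :=
  Module.compHom _ (algebraMap K (O.sec U))

instance (E : Mod O) (U : Opens X) : IsScalarTower K (O.sec U) (Sec E U) :=
  ⟨fun r f s => by rw [Algebra.smul_def, mul_smul]; rfl⟩

/-- Restriction of sections, a semilinear map. -/
def Sec.res (E : Mod O) {U V : Opens X} (h : V ≤ U) :
    Sec E U →ₛₗ[(O.res h : O.sec U →+* O.sec V)] Sec E V where
  toFun s := E.val.map (homOfLE h).op s
  map_add' s t := map_add (E.val.map (homOfLE h).op).hom s t
  map_smul' f s := E.val.map_smul (homOfLE h).op f s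

/-- Evaluation of a morphism. -/
def homApp {E F : Mod O} (φ : E ⟶ F) (U : Opens X) : Sec E U →ₗ[O.sec U] Sec F U :=
  (φ.val.app (op U)).hom

theorem homApp_res {E F : Mod O} (φ : E ⟶ F) {U V : Opens X} (h : V ≤ U) (s : Sec E U) :
    homApp φ V (Sec.res E h s) = Sec.res F h (homApp φ U s) :=
  PresheafOfModules.naturality_apply φ.val (homOfLE h).op s

theorem Sec.res_res (E : Mod O) {U V W : Opens X} (h : V ≤ U) (h' : W ≤ V) (s : Sec E U) :
    Sec.res E h' (Sec.res E h s) = Sec.res E (h'.trans h) s :=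
  (E.val.map_comp_apply (homOfLE h).op (homOfLE h').op s).symm

/-- Families of elements of `A(V)`, for `V` running through the open subsets of `U`. -/
def Fam (A : Opens X → Type u) (U : Opens X) : Type u := ∀ V : {V : Opens X // V ≤ U}, A V

instance (A : Opens X → Type u) [∀ V, AddCommGroup (A V)] (U : Opens X) :
    AddCommGroup (Fam A U) :=
  inferInstanceAs (AddCommGroup (∀ V : {V : Opens X // V ≤ U}, A V))

instance instModuleFam (A : Opens X → Type u) [∀ V, AddCommGroup (A V)]
    [∀ V, Module (O.sec V) (A V)] (U : Opens X) : Module (O.sec U) (Fam A U) where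
  smul f s := fun V => O.res V.2 f • s V
  one_smul s := by
    funext V
    exact (congrArg (· • s V) (map_one (O.res V.2))).trans (one_smul _ _)
  mul_smul f g s := by
    funext V
    exact (congrArg (· • s V) (map_mul (O.res V.2) f g)).trans (mul_smul _ _ _)
  smul_zero f := by funext V; exact smul_zero (O.res V.2 f)
  smul_add f s t := by funext V; exact smul_add (O.res V.2 f) (s V) (t V)
  add_smul f g s := by
    funext V
    exact (congrArg (· • s V) (map_add (O.res V.2) f g)).trans
      (add_smul (O.res V.2 f) (O.res V.2 g) (s V))
  zero_smul s := by
    funext V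
    exact (congrArg (· • s V) (map_zero (O.res V.2))).trans (zero_smul (O.sec V) (s V))

theorem Fam.add_apply (A : Opens X → Type u) [∀ V, AddCommGroup (A V)] {U : Opens X}
    (s t : Fam A U) (V : {V : Opens X // V ≤ U}) : (s + t) V = s V + t V := rfl

theorem Fam.smul_apply (A : Opens X → Type u) [∀ V, AddCommGroup (A V)]
    [∀ V, Module (O.sec V) (A V)] {U : Opens X} (f : O.sec U) (s : Fam A U)
    (V : {V : Opens X // V ≤ U}) : (f • s) V = O.res V.2 f • s V := rfl

variable (O) in
/-- The `O(U)`-module of `K`-linear derivations of the sheaf `O|_U`: families of `K`-derivations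
of `O(V)`, `V ⊆ U`, that commute with restriction. -/
def derSubmodule (U : Opens X) :
    Submodule (O.sec U) (Fam (fun V => Derivation K (O.sec V) (O.sec V)) U) where
  carrier := {D | ∀ (V W : {V : Opens X // V ≤ U}) (h : W.1 ≤ V.1) (f : O.sec V),
    O.res h (D V f) = D W (O.res h f)}
  add_mem' {D D'} hD hD' V W h f := by
    rw [Fam.add_apply, Fam.add_apply, Derivation.add_apply, Derivation.add_apply, map_add,
      hD V W h, hD' V W h]
  zero_mem' V W h f := map_zero (O.res h)
  smul_mem' g D hD V W h f := by
    change O.res h (O.res V.2 g * D V f) = O.res W.2 g * D W (O.res h f)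
    rw [map_mul, hD V W h]
    rfl

variable (O) in
/-- `Der_K(O|_U)`, the sections over `U` of the tangent sheaf `T_X = Der_K(O)`. -/
def Der (U : Opens X) : Type u := derSubmodule O U

instance (U : Opens X) : AddCommGroup (Der O U) := (derSubmodule O U).addCommGroup

instance (U : Opens X) : Module (O.sec U) (Der O U) :=
  (derSubmodule O U).module

/-- Restriction of derivations. -/
def Der.res {U V : Opens X} (h : V ≤ U) : Der O U →ₛₗ[(O.res h : O.sec U →+* O.sec V)] Der O V where
  toFun D := ⟨fun W => D.1 ⟨W.1, W.2.trans h⟩, fun W W' hW f => D.2 ⟨W.1, W.2.trans h⟩ ⟨W'.1, W'.2.trans h⟩ hW f⟩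
  map_add' _ _ := rfl
  map_smul' _ _ := rfl

variable (O) in
/-- The presheaf of abelian groups of derivations. -/
def derPresheaf : TopCat.Presheaf AddCommGrpCat.{u} X where
  obj U := AddCommGrpCat.of (Der O U.unop)
  map f := AddCommGrpCat.ofHom (Der.res (O := O) (leOfHom f.unop)).toAddMonoidHom
  map_id _ := rfl
  map_comp _ _ := rfl

theorem sec_ext {U : Opens X} {f g : O.sec U} {ι : Type*} (V : ι → Opens X) (hV : U ≤ iSup V)
    (h : ∀ i, O.res (inf_le_left : U ⊓ V i ≤ U) f = O.res inf_le_left g) : f = g := by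
  refine Subtype.ext (funext fun x => ?_)
  obtain ⟨i, hi⟩ := Opens.mem_iSup.1 (hV x.2)
  exact congrFun (congrArg Subtype.val (h i)) ⟨x, x.2, hi⟩

theorem derPresheaf_isSheaf : (derPresheaf O).IsSheaf := by
  rw [TopCat.Presheaf.isSheaf_iff_isSheafUniqueGluing]
  intro ι U sf hsf
  let D : ∀ i, Der O (U i) := sf
  have hD : ∀ (i j : ι) (W : Opens X) (hi : W ≤ U i) (hj : W ≤ U j),
      (D i).1 ⟨W, hi⟩ = (D j).1 ⟨W, hj⟩ := fun i j W hi hj =>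
    congrFun (congrArg (Subtype.val : Der O (U i ⊓ U j) → _) (hsf i j)) ⟨W, le_inf hi hj⟩
  -- the value at a point of the glued derivation
  have hmem : ∀ x : ↥(iSup U), ∃ i, (x : X) ∈ U i := fun x => Opens.mem_iSup.1 x.2
  choose c hc using hmem
  let val : ∀ (V : {V : Opens X // V ≤ iSup U}) (f : O.sec V.1) (x : V.1), K := fun V f x =>
    ((D (c ⟨x, V.2 x.2⟩)).1 ⟨V.1 ⊓ U (c ⟨x, V.2 x.2⟩), inf_le_right⟩ (O.res inf_le_left f)).1
      ⟨x, x.2, hc ⟨x, V.2 x.2⟩⟩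
  have hval : ∀ (V : {V : Opens X // V ≤ iSup U}) (f : O.sec V.1) (x : V.1) (i : ι)
      (W : Opens X) (hW : W ≤ V.1) (hi : W ≤ U i) (hx : (x : X) ∈ W),
      val V f x = ((D i).1 ⟨W, hi⟩ (O.res hW f)).1 ⟨x, hx⟩ := by
    intro V f x i W hW hi hx
    let i' := c ⟨x, V.2 x.2⟩
    let N := W ⊓ (V.1 ⊓ U i')
    have e1 := (D i).2 ⟨W, hi⟩ ⟨N, inf_le_left.trans hi⟩ inf_le_left (O.res hW f)
    have e2 := (D i').2 ⟨V.1 ⊓ U i', inf_le_right⟩ ⟨N, inf_le_right.trans inf_le_right⟩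
      inf_le_right (O.res inf_le_left f)
    have hN : N ≤ U i' := inf_le_right.trans inf_le_right
    have hxN : (x : X) ∈ N := ⟨hx, x.2, hc ⟨x, V.2 x.2⟩⟩
    have e1' := congrFun (congrArg Subtype.val e1) ⟨x, hxN⟩
    have e2' := congrFun (congrArg Subtype.val e2) ⟨x, hxN⟩
    rw [hD i i' N _ hN] at e1'
    exact e2'.trans e1'.symm
  have hsec : ∀ (V : {V : Opens X // V ≤ iSup U}) (f : O.sec V.1), val V f ∈ O.sec V.1 := by
    intro V f
    refine O.mem_of_locally fun x => ?_
    refine ⟨V.1 ⊓ U (c ⟨x, V.2 x.2⟩), inf_le_left, ⟨x.2, hc ⟨x, V.2 x.2⟩⟩, ?_⟩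
    convert ((D (c ⟨x, V.2 x.2⟩)).1 ⟨V.1 ⊓ U (c ⟨x, V.2 x.2⟩), inf_le_right⟩
      (O.res inf_le_left f)).2 using 1
    funext y
    exact hval V f ⟨y, y.2.1⟩ _ _ _ _ y.2
  let T : Fam (fun V => Derivation K (O.sec V) (O.sec V)) (iSup U) := fun V =>
    Derivation.mk'
      { toFun := fun f => ⟨val V f, hsec V f⟩
        map_add' := fun f g => Subtype.ext (funext fun x => by
          change ((D _).1 _ (O.res _ (f + g))).1 _ = ((D _).1 _ _).1 _ + ((D _).1 _ _).1 _
          rw [map_add, map_add]; rfl)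
        map_smul' := fun r f => Subtype.ext (funext fun x => by
          change ((D _).1 _ (O.res _ (r • f))).1 _ = r • ((D _).1 _ _).1 _
          rw [map_smul]
          exact congrFun (congrArg Subtype.val (Derivation.map_smul _ _ _)) _) }
      (fun f g => Subtype.ext (funext fun x => by
        change ((D _).1 _ (O.res _ (f * g))).1 _ =
          f.1 x * ((D _).1 _ _).1 _ + g.1 x * ((D _).1 _ _).1 _
        rw [map_mul, Derivation.leibniz]; rfl))
  have hT : ∀ i (W : {V : Opens X // V ≤ U i}),
      T ⟨W.1, W.2.trans (le_iSup U i)⟩ = (D i).1 W := by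
    intro i W
    refine Derivation.ext fun f => Subtype.ext (funext fun x => ?_)
    exact hval ⟨W.1, W.2.trans (le_iSup U i)⟩ f x i W.1 le_rfl W.2 x.2
  have hTmem : T ∈ derSubmodule O (iSup U) := by
    intro V W h f
    refine Subtype.ext (funext fun x => ?_)
    have hx := hc ⟨x, W.2 x.2⟩
    exact (hval V f ⟨x, h x.2⟩ _ (W.1 ⊓ U (c ⟨x, W.2 x.2⟩)) (inf_le_left.trans h) inf_le_right
      ⟨x.2, hx⟩).trans (hval W (O.res h f) x _ (W.1 ⊓ U (c ⟨x, W.2 x.2⟩)) inf_le_left inf_le_right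
      ⟨x.2, hx⟩).symm
  refine ⟨(⟨T, hTmem⟩ : Der O (iSup U)), fun i => Subtype.ext (funext fun W => hT i W), ?_⟩
  intro S hS
  let S' : Der O (iSup U) := S
  have hS' : ∀ i (W : {V : Opens X // V ≤ U i}),
      S'.1 ⟨W.1, W.2.trans (le_iSup U i)⟩ = (D i).1 W := fun i W =>
    congrFun (congrArg (Subtype.val : Der O (U i) → _) (hS i)) W
  change S' = ⟨T, hTmem⟩
  refine Subtype.ext (funext fun V => Derivation.ext fun f => ?_)
  refine sec_ext U V.2 fun i => ?_
  rw [S'.2 V ⟨V.1 ⊓ U i, inf_le_left.trans V.2⟩ inf_le_left,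
    hTmem V ⟨V.1 ⊓ U i, inf_le_left.trans V.2⟩ inf_le_left,
    hS' i ⟨V.1 ⊓ U i, inf_le_right⟩, hT i ⟨V.1 ⊓ U i, inf_le_right⟩]


instance instModuleDer (U : (Opens X)ᵒᵖ) :
    Module (O.ringSheaf.obj.obj U) ((derPresheaf O).obj U) :=
  (derSubmodule O U.unop).module

variable (O) in
/-- The presheaf `U ↦ Der_K(O|_U)` of `O`-modules. -/
def derPresheafOfModules : PresheafOfModules.{u} O.ringSheaf.obj :=
  PresheafOfModules.ofPresheaf (derPresheaf O) fun {U V} f r m =>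
    (Der.res (O := O) (U := U.unop) (V := V.unop) (leOfHom f.unop)).map_smulₛₗ r m

variable (O) in
/-- The tangent sheaf `T_X = Der_K(O)`, as a sheaf of `O`-modules. -/
def tangentSheaf : Mod O where
  val := derPresheafOfModules O
  isSheaf := derPresheaf_isSheaf (O := O)

/-- Sections of the tangent sheaf over `U` are derivations of `O|_U`. -/
def toDer (U : Opens X) : Sec (tangentSheaf O) U →ₗ[O.sec U] Der O U where
  toFun D := D
  map_add' _ _ := rfl
  map_smul' _ _ := rfl


/-! ### Morphisms into the tangent sheaf -/

/-- For a morphism `a : E ⟶ T_X`, the `K`-derivation of `O(U)` given by `a(D)`, for a section `D`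
of `E` over `U`. -/
def anchorAt {E : Mod O} (a : E ⟶ tangentSheaf O) (U : Opens X) :
    Sec E U →ₗ[O.sec U] Derivation K (O.sec U) (O.sec U) where
  toFun D := (toDer U (homApp a U D)).1 ⟨U, le_rfl⟩
  map_add' D D' := by rw [map_add, map_add]; rfl
  map_smul' f D := by rw [map_smul, map_smul]; rfl

theorem anchorAt_res {E : Mod O} (a : E ⟶ tangentSheaf O) {U V : Opens X} (h : V ≤ U)
    (D : Sec E U) (f : O.sec U) :
    O.res h (anchorAt a U D f) = anchorAt a V (Sec.res E h D) (O.res h f) := by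
  have h1 := (toDer U (homApp a U D)).2 ⟨U, le_rfl⟩ ⟨V, h⟩ h f
  have h2 : toDer V (homApp a V (Sec.res E h D)) = Der.res h (toDer U (homApp a U D)) := by
    rw [homApp_res]; rfl
  refine h1.trans ?_
  change _ = (toDer V (homApp a V (Sec.res E h D))).1 ⟨V, le_rfl⟩ (O.res h f)
  rw [h2]
  rfl

/-- A Lie algebroid structure on a sheaf of `O`-modules `E`: a structure of a sheaf of `K`-Lie
algebras on `E` and an `O`-linear morphism of sheaves `E ⟶ T_X`, the anchor, that preserves
brackets and satisfies `[D, f D'] = f [D, D'] + a(D)(f) D'`. -/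
structure LieAlgebroidStr (E : Mod O) where
  /-- The bracket on the sections over `U`. -/
  bracket (U : Opens X) : Sec E U →ₗ[K] Sec E U →ₗ[K] Sec E U
  bracket_self (U : Opens X) (D : Sec E U) : bracket U D D = 0
  jacobi (U : Opens X) (D₁ D₂ D₃ : Sec E U) :
    bracket U D₁ (bracket U D₂ D₃) + bracket U D₂ (bracket U D₃ D₁) +
      bracket U D₃ (bracket U D₁ D₂) = 0
  bracket_res {U V : Opens X} (h : V ≤ U) (D D' : Sec E U) :
    Sec.res E h (bracket U D D') = bracket V (Sec.res E h D) (Sec.res E h D')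
  /-- The anchor. -/
  anchor : E ⟶ tangentSheaf O
  anchor_bracket (U : Opens X) (D D' : Sec E U) :
    anchorAt anchor U (bracket U D D') = ⁅anchorAt anchor U D, anchorAt anchor U D'⁆
  leibniz (U : Opens X) (D : Sec E U) (f : O.sec U) (D' : Sec E U) :
    bracket U D (f • D') = f • bracket U D D' + anchorAt anchor U D f • D'


/-- The `O`-linear morphism `φ : E ⟶ F` is a morphism of Lie algebroids: it preserves brackets and
commutes with the anchors. -/
structure IsLieAlgebroidHom {E F : Mod O} (S : LieAlgebroidStr E) (T : LieAlgebroidStr F)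
    (φ : E ⟶ F) : Prop where
  map_bracket (U : Opens X) (D D' : Sec E U) :
    homApp φ U (S.bracket U D D') = T.bracket U (homApp φ U D) (homApp φ U D')
  anchor_comp : φ ≫ T.anchor = S.anchor

/-- The Lie algebroid `(E, S)` is an `(F, T)`-Lie algebroid: it admits a morphism of Lie algebroids
to `(F, T)`. -/
def IsLieAlgebroidOver {E F : Mod O} (S : LieAlgebroidStr E) (T : LieAlgebroidStr F) : Prop :=
  ∃ φ : E ⟶ F, IsLieAlgebroidHom S T φ

/-! ### Forms -/

/-- The `O(U)`-module of `k`-forms on `E` over `U`, that is, of morphisms of sheaves of modules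
`⋀^k E|_U → O|_U`: families of `O(V)`-multilinear alternating maps `E(V)^k → O(V)`, `V ⊆ U`, that
commute with restriction. -/
def formSubmodule (E : Mod O) (k : ℕ) (U : Opens X) :
    Submodule (O.sec U) (Fam (fun V => (Sec E V) [⋀^Fin k]→ₗ[O.sec V] O.sec V) U) where
  carrier := {ω | ∀ (V W : {V : Opens X // V ≤ U}) (h : W.1 ≤ V.1) (v : Fin k → Sec E V.1),
    O.res h (ω V v) = ω W (fun i => Sec.res E h (v i))}
  add_mem' {ω η} hω hη V W h v := by
    rw [Fam.add_apply, Fam.add_apply, AlternatingMap.add_apply, AlternatingMap.add_apply, map_add,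
      hω V W h, hη V W h]
  zero_mem' V W h v := map_zero (O.res h)
  smul_mem' g ω hω V W h v := by
    change O.res h (O.res V.2 g * ω V v) = O.res W.2 g * ω W _
    rw [map_mul, hω V W h]
    rfl

/-- The sections over `U` of `Ω^k_E = Hom_O(⋀^k E, O)`. For `k = 1` this is the dual `E^*`. -/
def Form (E : Mod O) (k : ℕ) (U : Opens X) : Type u := formSubmodule E k U

namespace Form

variable {E : Mod O} {k l m : ℕ} {U V : Opens X}

instance : AddCommGroup (Form E k U) := (formSubmodule E k U).addCommGroup

instance : Module (O.sec U) (Form E k U) :=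
  (formSubmodule E k U).module

instance : Module K (Form E k U) := Module.compHom _ (algebraMap K (O.sec U))

instance : IsScalarTower K (O.sec U) (Form E k U) :=
  ⟨fun r f s => by rw [Algebra.smul_def, mul_smul]; rfl⟩

/-- The alternating map on the sections over `V ⊆ U` that a `k`-form over `U` consists of. -/
def eval (ω : Form E k U) (V : Opens X) (h : V ≤ U) : (Sec E V) [⋀^Fin k]→ₗ[O.sec V] O.sec V :=
  ω.1 ⟨V, h⟩

/-- The form given by a compatible family of alternating maps. -/
def ofCompatible (ω : ∀ V : Opens X, V ≤ U → (Sec E V) [⋀^Fin k]→ₗ[O.sec V] O.sec V)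
    (hω : ∀ (V W : Opens X) (hV : V ≤ U) (h : W ≤ V) (v : Fin k → Sec E V),
      O.res h (ω V hV v) = ω W (h.trans hV) (fun i => Sec.res E h (v i))) : Form E k U :=
  ⟨fun V => ω V.1 V.2, fun V _ h v => hω V.1 _ V.2 h v⟩

theorem eval_ofCompatible (ω : ∀ V : Opens X, V ≤ U → (Sec E V) [⋀^Fin k]→ₗ[O.sec V] O.sec V)
    (hω : ∀ (V W : Opens X) (hV : V ≤ U) (h : W ≤ V) (v : Fin k → Sec E V),
      O.res h (ω V hV v) = ω W (h.trans hV) (fun i => Sec.res E h (v i))) (V : Opens X)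
    (h : V ≤ U) : (ofCompatible ω hω).eval V h = ω V h := rfl

theorem ext {ω η : Form E k U} (h : ∀ (V : Opens X) (hV : V ≤ U) (v : Fin k → Sec E V),
    ω.eval V hV v = η.eval V hV v) : ω = η :=
  Subtype.ext (funext fun V => AlternatingMap.ext fun v => h V.1 V.2 v)

theorem eval_res (ω : Form E k U) {V W : Opens X} (hV : V ≤ U) (h : W ≤ V)
    (v : Fin k → Sec E V) :
    O.res h (ω.eval V hV v) = ω.eval W (h.trans hV) (fun i => Sec.res E h (v i)) :=
  ω.2 ⟨V, hV⟩ ⟨W, h.trans hV⟩ h v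

theorem add_eval (ω η : Form E k U) (h : V ≤ U) : (ω + η).eval V h = ω.eval V h + η.eval V h := rfl

theorem smul_eval (f : O.sec U) (ω : Form E k U) (h : V ≤ U) :
    (f • ω).eval V h = O.res h f • ω.eval V h := rfl

theorem smulK_eval (r : K) (ω : Form E k U) (h : V ≤ U) (v : Fin k → Sec E V) :
    (r • ω).eval V h v = r • ω.eval V h v := by
  change O.res h (algebraMap K (O.sec U) r) * ω.eval V h v = _
  rw [AlgHom.commutes, Algebra.smul_def]

/-- Restriction of forms. -/
def res (h : V ≤ U) : Form E k U →ₛₗ[(O.res h : O.sec U →+* O.sec V)] Form E k V where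
  toFun ω := ofCompatible (fun W hW => ω.eval W (hW.trans h)) fun _ _ hV hW v => ω.eval_res (hV.trans h) hW v
  map_add' _ _ := rfl
  map_smul' _ _ := rfl

/-- A function as a `0`-form. -/
def ofFun : O.sec U →ₗ[O.sec U] Form E 0 U where
  toFun f := ofCompatible (fun V h => AlternatingMap.constOfIsEmpty (O.sec V) (Sec E V) (Fin 0) (O.res h f))
    fun _ _ _ _ _ => rfl
  map_add' _ _ := ext fun _ hV _ => map_add (O.res hV) _ _
  map_smul' _ _ := ext fun _ hV _ => map_mul (O.res hV) _ _

/-- The wedge product of forms: the signed sum over `(k, l)`-shuffles of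
`ω(v_σ(1), …, v_σ(k)) η(v_σ(k+1), …, v_σ(k+l))`. -/
def wedge (e : k + l = m) (ω : Form E k U) (η : Form E l U) : Form E m U :=
  ofCompatible (fun V h => ((LinearMap.mul' (O.sec V) (O.sec V)).compAlternatingMap
      ((ω.eval V h).domCoprod (η.eval V h))).domDomCongr (finSumFinEquiv.trans (finCongr e)))
    fun V W hV h v => LieRinehart.map_mul'_domCoprod (O.res h : O.sec V →+* O.sec W)
      (Sec.res E h) _ _ _ _ (ω.eval_res hV h) (η.eval_res hV h)
      (fun i => v ((finSumFinEquiv.trans (finCongr e)) i))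


/-- `1`-forms as linear maps. -/
def toLin (α : Form E 1 U) (V : Opens X) (h : V ≤ U) : Sec E V →ₗ[O.sec V] O.sec V :=
  (AlternatingMap.ofSubsingleton (O.sec V) (Sec E V) (O.sec V) (0 : Fin 1)).symm (α.eval V h)

theorem toLin_apply (α : Form E 1 U) (V : Opens X) (h : V ≤ U) (D : Sec E V) :
    α.toLin V h D = α.eval V h (fun _ => D) := rfl

/-- The `k`-form `(v₁, …, v_k) ↦ det (αⱼ(vᵢ))` attached to `1`-forms `α₁, …, α_k`. -/
def wedgeOne (α : Fin k → Form E 1 U) : Form E k U :=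
  ofCompatible (fun V h => LieRinehart.detForm fun j => (α j).toLin V h) fun V W hV h v => by
    rw [LieRinehart.detForm_apply, LieRinehart.detForm_apply, AlgHom.map_det]
    congr 1
    ext1 i j
    exact (α j).eval_res hV h _

variable (E k U) in
/-- `(α₁, …, α_k) ↦ ((v₁, …, v_k) ↦ det (αⱼ(vᵢ)))` as an alternating map. -/
def wedgeOneAlt : (Form E 1 U) [⋀^Fin k]→ₗ[O.sec U] Form E k U where
  toFun := wedgeOne
  map_update_add' {inst} α i β γ := by
    obtain rfl : inst = instDecidableEqFin _ := Subsingleton.elim _ _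
    refine ext fun V hV v => ?_
    have h : ∀ β : Form E 1 U, (wedgeOne (Function.update α i β)).eval V hV v =
        (Matrix.updateCol (Matrix.of fun p q => (α q).toLin V hV (v p)) i
          (fun p => β.toLin V hV (v p))).det := fun β => by
      refine (LieRinehart.detForm_apply _ _).trans ?_
      congr 1
      ext1 p q
      rcases eq_or_ne q i with rfl | hq <;> simp [*]
    rw [add_eval, AlternatingMap.add_apply, h, h, h, ← Matrix.det_updateCol_add]
    rfl
  map_update_smul' {inst} α i f β := by
    obtain rfl : inst = instDecidableEqFin _ := Subsingleton.elim _ _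
    refine ext fun V hV v => ?_
    have h : ∀ β : Form E 1 U, (wedgeOne (Function.update α i β)).eval V hV v =
        (Matrix.updateCol (Matrix.of fun p q => (α q).toLin V hV (v p)) i
          (fun p => β.toLin V hV (v p))).det := fun β => by
      refine (LieRinehart.detForm_apply _ _).trans ?_
      congr 1
      ext1 p q
      rcases eq_or_ne q i with rfl | hq <;> simp [*]
    rw [smul_eval, AlternatingMap.smul_apply, h, h, smul_eq_mul, ← Matrix.det_updateCol_smul]
    rfl
  map_eq_zero_of_eq' α i j hα hij := by
    refine ext fun V hV v => ?_
    refine (LieRinehart.detForm_apply _ _).trans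
      (Matrix.det_zero_of_column_eq hij fun p => ?_)
    simp [hα]

variable (E k U) in
/-- The canonical map `⋀^k (E^*(U)) → Ω^k_E(U)`,
`α₁ ∧ … ∧ α_k ↦ ((v₁, …, v_k) ↦ det (αⱼ(vᵢ)))`. -/
def ofExteriorPower : ⋀[O.sec U]^k (Form E 1 U) →ₗ[O.sec U] Form E k U :=
  exteriorPower.alternatingMapLinearEquiv (wedgeOneAlt E k U)

end Form

/-- The canonical map identifies the exterior algebra `⋀^• E^*` with the graded algebra `Ω^•_E` of
forms: it is multiplicative, and on the members of a neighbourhood basis of each point it is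
bijective, so that it is an isomorphism of sheaves after sheafification. -/
structure FormsAreExteriorAlgebra (E : Mod O) : Prop where
  /-- The canonical map is multiplicative. -/
  mul (k l : ℕ) (U : Opens X) (s : ⋀[O.sec U]^k (Form E 1 U)) (t : ⋀[O.sec U]^l (Form E 1 U)) :
    Form.ofExteriorPower E (k + l) U ⟨s.1 * t.1, SetLike.mul_mem_graded s.2 t.2⟩ =
      Form.wedge rfl (Form.ofExteriorPower E k U s) (Form.ofExteriorPower E l U t)
  /-- The canonical map is bijective on all sufficiently small open sets. -/
  bijective (k : ℕ) (x : X) : ∃ U : Opens X, x ∈ U ∧ ∀ V : Opens X, V ≤ U →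
    Function.Bijective (Form.ofExteriorPower E k V)

/-! ### Differential graded algebras of forms -/

/-- A `K`-linear sheaf operator of degree `1` on the graded sheaf `Ω^•_E` of forms. -/
@[ext]
structure FormOperator (E : Mod O) where
  app (k : ℕ) (U : Opens X) : Form E k U →ₗ[K] Form E (k + 1) U
  app_res (k : ℕ) {U V : Opens X} (h : V ≤ U) (ω : Form E k U) :
    app k V (Form.res h ω) = Form.res h (app k U ω)

/-- The graded algebra `Ω^•_E`, with the operator `d`, is a sheaf of differential graded algebras:
`d ∘ d = 0` and `d(ω ∧ η) = dω ∧ η + (-1)^k ω ∧ dη` for a `k`-form `ω`. -/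
structure IsDGA {E : Mod O} (d : FormOperator E) : Prop where
  sq_zero (k : ℕ) (U : Opens X) (ω : Form E k U) : d.app (k + 1) U (d.app k U ω) = 0
  leibniz (k l : ℕ) (U : Opens X) (ω : Form E k U) (η : Form E l U) :
    d.app (k + l) U (Form.wedge rfl ω η) =
      Form.wedge (by omega) (d.app k U ω) η +
        (-1 : ℤ) ^ k • Form.wedge (by omega) ω (d.app l U η)

/-- An `O`-linear morphism `Ω^•_E → Ω^•_F` of graded sheaves. -/
@[ext]
structure FormHom (E F : Mod O) where
  app (k : ℕ) (U : Opens X) : Form E k U →ₗ[O.sec U] Form F k U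
  app_res (k : ℕ) {U V : Opens X} (h : V ≤ U) (ω : Form E k U) :
    app k V (Form.res h ω) = Form.res h (app k U ω)

/-- The graded `O`-linear morphism `ψ` is a morphism of sheaves of differential graded algebras
`(Ω^•_E, dE) → (Ω^•_F, dF)`. -/
structure IsDGAHom {E F : Mod O} (dE : FormOperator E) (dF : FormOperator F) (ψ : FormHom E F) :
    Prop where
  map_one (U : Opens X) : ψ.app 0 U (Form.ofFun 1) = Form.ofFun 1
  map_wedge (k l : ℕ) (U : Opens X) (ω : Form E k U) (η : Form E l U) :
    ψ.app (k + l) U (Form.wedge rfl ω η) = Form.wedge rfl (ψ.app k U ω) (ψ.app l U η)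
  map_d (k : ℕ) (U : Opens X) (ω : Form E k U) :
    ψ.app (k + 1) U (dE.app k U ω) = dF.app k U (ψ.app k U ω)

/-- The pull-back of forms `φ^* : Ω^•_F → Ω^•_E` along an `O`-linear morphism `φ : E ⟶ F`. -/
def pullback {E F : Mod O} (φ : E ⟶ F) : FormHom F E where
  app k U :=
    { toFun := fun ω => Form.ofCompatible (fun V h => (ω.eval V h).compLinearMap (homApp φ V))
        fun V W hV h v => by
          rw [AlternatingMap.compLinearMap_apply, AlternatingMap.compLinearMap_apply, ω.eval_res]
          simp only [homApp_res]
      map_add' := fun _ _ => rfl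
      map_smul' := fun _ _ => rfl }
  app_res _ _ _ _ _ := rfl

/-- The Chevalley–Eilenberg–de Rham differential `d_E` on `Ω^•_E` of the Lie algebroid `(E, S)`. -/
def ceOperator [CharZero K] {E : Mod O} (S : LieAlgebroidStr E) : FormOperator E where
  app k U :=
    { toFun := fun ω => Form.ofCompatible
        (fun V h => LieRinehart.ceDiff (S.bracket V) (S.bracket_self V) (anchorAt S.anchor V)
          (S.leibniz V) (ω.eval V h))
        fun V W hV h v => LieRinehart.map_ceFormula (O.res h : O.sec V →+* O.sec W)
          (Sec.res E h : Sec E V →+ Sec E W) _ _ _ _ (S.bracket_res h)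
          (anchorAt_res S.anchor h) _ _ (ω.eval_res hV h) v
      map_add' := fun ω η => Form.ext fun V hV v => LieRinehart.ceFormula_add _ _ _ _ _
      map_smul' := fun r ω => Form.ext fun V hV v => by
        rw [Form.smulK_eval]
        refine Eq.trans ?_ (LieRinehart.ceFormula_smul _ _ _ _ _)
        change LieRinehart.ceFormula _ _ ((r • ω).eval V hV) v = _
        congr 1 }
  app_res _ _ _ _ _ := rfl

variable (O) in
/-- The differential `d_X : O → Ω^1_X = Hom_O(T_X, O)`, `d_X f (D) = D(f)`. -/
def dX (U : Opens X) (f : O.sec U) : Form (tangentSheaf O) 1 U :=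
  Form.ofCompatible (fun V h => AlternatingMap.ofSubsingleton (O.sec V) _ (O.sec V) (0 : Fin 1)
      { toFun := fun D => (toDer V D).1 ⟨V, le_rfl⟩ (O.res h f)
        map_add' := fun D D' => by rw [map_add]; rfl
        map_smul' := fun g D => by rw [map_smul]; rfl })
    fun V W hV h v => (toDer V (v 0)).2 ⟨V, le_rfl⟩ ⟨W, h⟩ h (O.res hV f)

/-- In degree `0` the operator `d` is the composition `ψ₁ ∘ a_L^* ∘ d_X` of
`O → Ω^1_X → Ω^1_L → Ω^1_E`, where `a_L^*` is the dual of the anchor of `(L, T)`. -/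
def FactorsThroughAnchor {L E : Mod O} (T : LieAlgebroidStr L) (d : FormOperator E)
    (ψ : FormHom L E) : Prop :=
  ∀ (U : Opens X) (f : O.sec U),
    d.app 0 U (Form.ofFun f) = ψ.app 1 U ((pullback T.anchor).app 1 U (dX O U f))

/-- `(Ω^•_E, d)` is a differential graded algebra, and the morphism `ψ` makes it an
`Ω^•_L`-differential graded algebra, `Ω^•_L` being the Chevalley–Eilenberg–de Rham complex of the
Lie algebroid `(L, T)`. -/
structure IsOmegaDGA [CharZero K] {L E : Mod O} (T : LieAlgebroidStr L) (d : FormOperator E)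
    (ψ : FormHom L E) : Prop where
  isDGA : IsDGA d
  isDGAHom : IsDGAHom (ceOperator T) d ψ
  factors : FactorsThroughAnchor T d ψ

/-- The sheaf of `O`-modules `E` is locally free of finite rank: locally on `X` it is isomorphic
to `O^n` for some `n`. -/
def IsLocallyFreeOfFiniteRank (E : Mod O) : Prop :=
  ∀ x : X, ∃ U : Opens X, x ∈ U ∧ ∃ n : ℕ,
    ∃ e : ∀ V : Opens X, V ≤ U → (Sec E V ≃ₗ[O.sec V] (Fin n → O.sec V)),
      ∀ (V W : Opens X) (hV : V ≤ U) (h : W ≤ V) (s : Sec E V) (i : Fin n),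
        e W (h.trans hV) (Sec.res E h s) i = O.res h (e V hV s i)

end TopRingedSpace

end

/-! A Lie algebroid structure and a differential on forms determine each other through the
Chevalley–Eilenberg formula in degrees 0 and 1: `df(D) = a(D)(f)` and `dα(D, D') = a(D)(α(D')) -
a(D')(α(D)) - α([D, D'])`. Higher degrees carry no new information, because locally every form is a
sum of products of functions and 1-forms. That is the first assertion: over an open set with a frame
a form is determined by its alternating map on the sections over that set (`Frame.eval_injective`),
and for a free module `M` of finite rank `⋀^k M^*` is the module of alternating `k`-forms
(`detFormLinear_bijective`).

From an algebroid to a differential graded algebra: contraction with `x` is an antiderivation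
(`curryLeft_wedgeAlt`), the Lie derivative is a derivation (`lieAlt_wedgeAlt`), and Cartan's formula
`ceFormula_vecCons` relates both to `d`; induction on the degree then gives the Leibniz rule
`ceDiff_wedgeAlt`. On functions `d²` vanishes because the anchor preserves brackets, on 1-forms it
is minus the Jacobiator (`ceFormula_ceFormula_linForm`), and the Leibniz rule carries `d² = 0` to
all degrees. Pull-back along a homomorphism respects everything by naturality of the formula.

Conversely, `d` on functions defines the anchor. Solving the degree 1 formula for `α([D, D'])` gives
a functional of `α`, which the Leibniz rule makes `O`-linear; since `E` is reflexive
(`exists_section`) it is evaluation at a section, the bracket. Then `d` is the Chevalley–Eilenberg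
differential of these data (`eval_app_eq_ceDiff`), and `d² = 0` on functions and on coordinate
forms, read backwards, says that the anchor preserves brackets and that the Jacobi identity holds.
In the same way reflexivity of `L` turns the degree 1 part of `ψ` into the transpose of a morphism
`φ`, and multiplicativity gives `ψ = φ^*`. Compatibility of `φ` with the anchors is the condition on
`d` in degree 0, and compatibility with the brackets is `ψ d = d ψ` on 1-forms. -/

noncomputable section

namespace LieRinehart

/-! ### Wedge products of alternating maps, and exterior powers of the dual of a free module. -/

section Wedge

variable {A M : Type*} [CommRing A] [AddCommGroup M] [Module A M]

/-- The wedge product of two scalar valued alternating maps. -/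
def wedgeAlt {k l m : ℕ} (e : k + l = m) (ω : M [⋀^Fin k]→ₗ[A] A) (η : M [⋀^Fin l]→ₗ[A] A) :
    M [⋀^Fin m]→ₗ[A] A :=
  ((LinearMap.mul' A A).compAlternatingMap (ω.domCoprod η)).domDomCongr
    (finSumFinEquiv.trans (finCongr e))

variable {k l m : ℕ}

theorem wedgeAlt_apply (e : k + l = m) (ω : M [⋀^Fin k]→ₗ[A] A) (η : M [⋀^Fin l]→ₗ[A] A)
    (v : Fin m → M) :
    wedgeAlt e ω η v = LinearMap.mul' A A (AlternatingMap.domCoprod' (ω ⊗ₜ[A] η)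
      fun i => v ((finSumFinEquiv.trans (finCongr e)) i)) := rfl

theorem wedgeAlt_add_left (e : k + l = m) (ω ω' : M [⋀^Fin k]→ₗ[A] A) (η : M [⋀^Fin l]→ₗ[A] A) :
    wedgeAlt e (ω + ω') η = wedgeAlt e ω η + wedgeAlt e ω' η := by
  ext v
  simp only [AlternatingMap.add_apply, wedgeAlt_apply, TensorProduct.add_tmul, map_add]

theorem wedgeAlt_add_right (e : k + l = m) (ω : M [⋀^Fin k]→ₗ[A] A) (η η' : M [⋀^Fin l]→ₗ[A] A) :
    wedgeAlt e ω (η + η') = wedgeAlt e ω η + wedgeAlt e ω η' := by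
  ext v
  simp only [AlternatingMap.add_apply, wedgeAlt_apply, TensorProduct.tmul_add, map_add]

theorem wedgeAlt_smul_left (e : k + l = m) (f : A) (ω : M [⋀^Fin k]→ₗ[A] A)
    (η : M [⋀^Fin l]→ₗ[A] A) : wedgeAlt e (f • ω) η = f • wedgeAlt e ω η := by
  ext v
  simp only [AlternatingMap.smul_apply, wedgeAlt_apply, ← TensorProduct.smul_tmul', map_smul]

theorem wedgeAlt_smul_right (e : k + l = m) (f : A) (ω : M [⋀^Fin k]→ₗ[A] A)
    (η : M [⋀^Fin l]→ₗ[A] A) : wedgeAlt e ω (f • η) = f • wedgeAlt e ω η := by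
  ext v
  simp only [AlternatingMap.smul_apply, wedgeAlt_apply, TensorProduct.tmul_smul, map_smul]

/-- The wedge product as a bilinear map. -/
def wedgeₗ (e : k + l = m) :
    (M [⋀^Fin k]→ₗ[A] A) →ₗ[A] (M [⋀^Fin l]→ₗ[A] A) →ₗ[A] M [⋀^Fin m]→ₗ[A] A :=
  LinearMap.mk₂ A (wedgeAlt e) (wedgeAlt_add_left e) (wedgeAlt_smul_left e) (wedgeAlt_add_right e)
    (fun f ω η => wedgeAlt_smul_right e f ω η)

theorem wedgeAlt_sub_right (e : k + l = m) (ω : M [⋀^Fin k]→ₗ[A] A) (η η' : M [⋀^Fin l]→ₗ[A] A) :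
    wedgeAlt e ω (η - η') = wedgeAlt e ω η - wedgeAlt e ω η' :=
  map_sub (wedgeₗ e ω) η η'

theorem wedgeAlt_sub_left (e : k + l = m) (ω ω' : M [⋀^Fin k]→ₗ[A] A) (η : M [⋀^Fin l]→ₗ[A] A) :
    wedgeAlt e (ω - ω') η = wedgeAlt e ω η - wedgeAlt e ω' η :=
  map_sub ((wedgeₗ e).flip η) ω ω'

theorem wedgeAlt_zsmul_right (e : k + l = m) (z : ℤ) (ω : M [⋀^Fin k]→ₗ[A] A)
    (η : M [⋀^Fin l]→ₗ[A] A) : wedgeAlt e ω (z • η) = z • wedgeAlt e ω η :=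
  map_zsmul (wedgeₗ e ω) z η

/-- A determinant form is the alternatization of the product `α₁ ⊗ … ⊗ α_k`, and the coproduct of
two alternatizations is the alternatization of the product of both. The sum over shuffles thus
becomes one Leibniz expansion over all permutations of `k + l` letters. -/
theorem wedgeAlt_detForm (e : k + l = m) (α : Fin k → M →ₗ[A] A) (β : Fin l → M →ₗ[A] A) :
    wedgeAlt e (detForm α) (detForm β) = detForm fun i => Fin.append α β (Fin.cast e.symm i) := by
  subst e
  have hdet : ∀ {p : ℕ} (γ : Fin p → M →ₗ[A] A), detForm γ =
      MultilinearMap.alternatization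
        ((MultilinearMap.mkPiAlgebra A (Fin p) A).compLinearMap γ) := by
    intro p γ
    ext v
    rw [detForm_apply, Matrix.det_apply, MultilinearMap.alternatization_apply]
    rfl
  ext v
  rw [wedgeAlt_apply, AlternatingMap.domCoprod'_apply, hdet α, hdet β,
    ← MultilinearMap.domCoprod_alternization, detForm_apply,
    ← Matrix.det_submatrix_equiv_self finSumFinEquiv, Matrix.det_apply,
    MultilinearMap.alternatization_apply, map_sum]
  refine Finset.sum_congr rfl fun σ _ => ?_
  rw [Units.smul_def, Units.smul_def, map_zsmul]
  congr 1
  simp [Fintype.prod_sum_type]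

/-- The canonical map `⋀^k M^* → Alt^k(M)`, `α₁ ∧ … ∧ α_k ↦ detForm α`. -/
def detFormLinear (A M : Type*) [CommRing A] [AddCommGroup M] [Module A M] (k : ℕ) :
    ⋀[A]^k (Module.Dual A M) →ₗ[A] M [⋀^Fin k]→ₗ[A] A :=
  exteriorPower.alternatingMapLinearEquiv.symm.toLinearMap ∘ₗ exteriorPower.pairingDual A M k

theorem detFormLinear_ιMulti (α : Fin k → Module.Dual A M) :
    detFormLinear A M k (exteriorPower.ιMulti A k α) = detForm α := by
  ext v
  rw [detForm_apply, ← exteriorPower.pairingDual_ιMulti_ιMulti]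
  rfl

/-- For a basis of `M`, the determinant pairing sends the basis of `⋀^k M^*` built from the dual
basis to the dual of the basis of `⋀^k M`, so it is an isomorphism `⋀^k M^* → (⋀^k M)^*`. -/
theorem detFormLinear_bijective {n : ℕ} (B : Module.Basis (Fin n) A M) :
    Function.Bijective (detFormLinear A M k) := by
  have h : exteriorPower.pairingDual A M k =
      ((B.dualBasis.exteriorPower k).equiv (B.exteriorPower k).dualBasis
        (Equiv.refl _)).toLinearMap := by
    refine (B.dualBasis.exteriorPower k).ext fun s => ?_
    rw [LinearEquiv.coe_coe, Module.Basis.equiv_apply, exteriorPower.basis_apply,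
      Module.Basis.coe_dualBasis, Module.Basis.coe_dualBasis, Equiv.refl_apply,
      exteriorPower.basis_coord]
    rfl
  rw [detFormLinear, h]
  exact exteriorPower.alternatingMapLinearEquiv.symm.bijective.comp (LinearEquiv.bijective _)

/-- Scalar valued alternating maps on a free module of finite rank are sums of multiples of the
forms `detForm α`. -/
theorem alternating_induction {n : ℕ} (B : Module.Basis (Fin n) A M)
    {p : (M [⋀^Fin k]→ₗ[A] A) → Prop} (add : ∀ ω η, p ω → p η → p (ω + η))
    (smul_detForm : ∀ (f : A) (α : Fin k → M →ₗ[A] A), p (f • detForm α)) (ω) : p ω := by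
  obtain ⟨t, rfl⟩ := (detFormLinear_bijective B).2 ω
  have ht : t ∈ Submodule.span A (Set.range (exteriorPower.ιMulti A k (M := Module.Dual A M))) := by
    rw [exteriorPower.ιMulti_span]; trivial
  induction ht using Submodule.closure_induction with
  | zero =>
    rw [map_zero, ← zero_smul A (detForm 0)]
    exact smul_detForm _ _
  | add x y _ _ hx hy => rw [map_add]; exact add _ _ hx hy
  | smul_mem f x hx =>
    obtain ⟨α, rfl⟩ := hx
    rw [map_smul, detFormLinear_ιMulti]
    exact smul_detForm _ _

/-- A linear form as an alternating map in one variable. -/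
abbrev linForm (α : M →ₗ[A] A) : M [⋀^Fin 1]→ₗ[A] A :=
  AlternatingMap.ofSubsingleton A M A (0 : Fin 1) α

theorem exists_eq_linForm (ω : M [⋀^Fin 1]→ₗ[A] A) : ∃ α, ω = linForm α :=
  ⟨_, ((AlternatingMap.ofSubsingleton A M A (0 : Fin 1)).apply_symm_apply ω).symm⟩

theorem detForm_one (α : Fin 1 → M →ₗ[A] A) : detForm α = linForm (α 0) := by
  ext v
  simp [detForm_apply]

theorem detForm_zero (α : Fin 0 → M →ₗ[A] A) :
    detForm α = AlternatingMap.constOfIsEmpty A M (Fin 0) 1 := by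
  ext v
  simp [detForm_apply]

theorem exists_eq_const (ω : M [⋀^Fin 0]→ₗ[A] A) :
    ω = AlternatingMap.constOfIsEmpty A M (Fin 0) (ω Fin.elim0) := by
  ext v
  rw [Subsingleton.elim v Fin.elim0]
  rfl

theorem detForm_vecCons (e : 1 + k = k + 1) (α : M →ₗ[A] A) (β : Fin k → M →ₗ[A] A) :
    detForm (Matrix.vecCons α β) = wedgeAlt e (linForm α) (detForm β) := by
  rw [← show detForm (fun _ : Fin 1 => α) = linForm α from detForm_one _, wedgeAlt_detForm,
    Fin.append_left_eq_cons]
  rfl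

/-- Scalar valued alternating maps of positive degree on a free module of finite rank are sums of
products with linear forms. -/
theorem alternating_induction_succ {n : ℕ} (B : Module.Basis (Fin n) A M)
    {p : (M [⋀^Fin (k + 1)]→ₗ[A] A) → Prop} (add : ∀ ω η, p ω → p η → p (ω + η))
    (wedge : ∀ (α : M →ₗ[A] A) (η : M [⋀^Fin k]→ₗ[A] A),
      p (wedgeAlt (Nat.add_comm 1 k) (linForm α) η)) (ω) : p ω := by
  refine alternating_induction B add (fun f α => ?_) ω
  rw [← Matrix.cons_head_tail α, detForm_vecCons (Nat.add_comm 1 k), ← wedgeAlt_smul_right]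
  exact wedge _ _

end Wedge

/-! ### The graded algebra of forms on a free module: units, associativity, contraction. -/

section WedgeFree

variable {A M : Type*} [CommRing A] [AddCommGroup M] [Module A M] {n : ℕ}
  (B : Module.Basis (Fin n) A M) {k l m : ℕ}

theorem const_eq_smul_detForm (f : A) (α : Fin 0 → M →ₗ[A] A) :
    AlternatingMap.constOfIsEmpty A M (Fin 0) f = f • detForm α := by
  rw [detForm_zero]
  ext
  simp

include B in
theorem wedgeAlt_const_left (e : 0 + k = k) (f : A) (η : M [⋀^Fin k]→ₗ[A] A) :
    wedgeAlt e (AlternatingMap.constOfIsEmpty A M (Fin 0) f) η = f • η := by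
  induction η using alternating_induction B with
  | add ω η h h' => rw [wedgeAlt_add_right, h, h', smul_add]
  | smul_detForm g β =>
    rw [const_eq_smul_detForm f Fin.elim0, wedgeAlt_smul_left, wedgeAlt_smul_right,
      wedgeAlt_detForm, Fin.elim0_append]
    rfl

include B in
theorem wedgeAlt_const_right (e : k + 0 = k) (f : A) (η : M [⋀^Fin k]→ₗ[A] A) :
    wedgeAlt e η (AlternatingMap.constOfIsEmpty A M (Fin 0) f) = f • η := by
  induction η using alternating_induction B with
  | add ω η h h' => rw [wedgeAlt_add_left, h, h', smul_add]
  | smul_detForm g β =>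
    rw [const_eq_smul_detForm f Fin.elim0, wedgeAlt_smul_left, wedgeAlt_smul_right,
      wedgeAlt_detForm, Fin.append_elim0, smul_comm]
    rfl

include B in
/-- Expansion of the product with a linear form. -/
theorem linForm_wedgeAlt_apply (e : 1 + k = k + 1) (α : M →ₗ[A] A) (η : M [⋀^Fin k]→ₗ[A] A)
    (v : Fin (k + 1) → M) :
    wedgeAlt e (linForm α) η v =
      ∑ i : Fin (k + 1), (-1 : ℤ) ^ (i : ℕ) • (α (v i) * η (i.removeNth v)) := by
  induction η using alternating_induction B with
  | add ω η h h' =>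
    simp only [wedgeAlt_add_right, AlternatingMap.add_apply, h, h', mul_add, smul_add,
      Finset.sum_add_distrib]
  | smul_detForm g β =>
    -- For a decomposable form this is the Laplace expansion of the determinant along the column of
    -- `α`.
    rw [wedgeAlt_smul_right, ← detForm_vecCons, AlternatingMap.smul_apply, detForm_apply,
      Matrix.det_succ_column_zero, Finset.smul_sum]
    refine Finset.sum_congr rfl fun i _ => ?_
    have h : (Matrix.of fun p q => Matrix.vecCons α β q (v p)).submatrix i.succAbove Fin.succ =
        Matrix.of fun p q => β q (i.removeNth v p) := by
      ext p q
      simp [Fin.removeNth]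
    rw [h, AlternatingMap.smul_apply, detForm_apply, zsmul_eq_mul]
    simp
    ring

-- All three arguments may be taken decomposable by multilinearity; the identity then is the
-- associativity of concatenating lists of linear forms.
include B in
theorem wedgeAlt_assoc {p q r : ℕ} (e₁ : k + l = p) (e₂ : p + m = r) (e₃ : l + m = q)
    (e₄ : k + q = r) (ω : M [⋀^Fin k]→ₗ[A] A) (η : M [⋀^Fin l]→ₗ[A] A)
    (ζ : M [⋀^Fin m]→ₗ[A] A) :
    wedgeAlt e₂ (wedgeAlt e₁ ω η) ζ = wedgeAlt e₄ ω (wedgeAlt e₃ η ζ) := by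
  induction ω using alternating_induction B with
  | add ω ω' h h' => simp only [wedgeAlt_add_left, h, h']
  | smul_detForm f α =>
  induction η using alternating_induction B with
  | add ω ω' h h' => simp only [wedgeAlt_add_left, wedgeAlt_add_right, h, h']
  | smul_detForm g β =>
  induction ζ using alternating_induction B with
  | add ω ω' h h' => simp only [wedgeAlt_add_right, h, h']
  | smul_detForm g β =>
    simp only [wedgeAlt_smul_left, wedgeAlt_smul_right, wedgeAlt_detForm]
    subst e₁ e₃ e₂
    congr 4
    funext i
    exact congrFun (Fin.append_assoc _ _ _) i

include B in
/-- Contraction of the product with a linear form. -/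
theorem curryLeft_linForm_wedgeAlt (e : 1 + (k + 1) = k + 1 + 1) (e' : 1 + k = k + 1)
    (α : M →ₗ[A] A) (η : M [⋀^Fin (k + 1)]→ₗ[A] A) (x : M) :
    (wedgeAlt e (linForm α) η).curryLeft x = α x • η - wedgeAlt e' (linForm α) (η.curryLeft x) := by
  ext w
  rw [AlternatingMap.curryLeft_apply_apply, linForm_wedgeAlt_apply B, Fin.sum_univ_succ,
    AlternatingMap.sub_apply, linForm_wedgeAlt_apply B, sub_eq_add_neg, ← Finset.sum_neg_distrib]
  congr 1
  · simp
  · refine Finset.sum_congr rfl fun i _ => ?_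
    rw [removeNth_succ_vecCons, Matrix.cons_val_succ, AlternatingMap.curryLeft_apply_apply,
      Fin.val_succ, pow_succ, mul_neg_one, neg_smul]

include B in
/-- Contraction with a vector is an antiderivation of degree `-1`. -/
theorem curryLeft_wedgeAlt (e : k + 1 + (l + 1) = m + 1) (e₁ : k + (l + 1) = m)
    (e₂ : k + 1 + l = m) (ω : M [⋀^Fin (k + 1)]→ₗ[A] A) (η : M [⋀^Fin (l + 1)]→ₗ[A] A) (x : M) :
    (wedgeAlt e ω η).curryLeft x = wedgeAlt e₁ (ω.curryLeft x) η +
      (-1 : ℤ) ^ (k + 1) • wedgeAlt e₂ ω (η.curryLeft x) := by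
  -- One linear form at a time is split off from `ω`; in the base case its contraction is the
  -- constant `α x`, and a wedge with a constant is a scalar multiple.
  induction k generalizing m with
  | zero =>
    obtain ⟨α, rfl⟩ := exists_eq_linForm ω
    obtain rfl : m = l + 1 := by omega
    have h : (linForm α).curryLeft x = AlternatingMap.constOfIsEmpty A M (Fin 0) (α x) := by
      ext; simp
    rw [curryLeft_linForm_wedgeAlt B (e' := e₂), h, wedgeAlt_const_left B]
    simp [sub_eq_add_neg]
  | succ k ih =>
    obtain ⟨m, rfl⟩ : ∃ m', m = m' + 1 := ⟨k + (l + 1), by omega⟩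
    induction ω using alternating_induction_succ B with
    | add ω ω' h h' =>
      simp only [wedgeAlt_add_left, AlternatingMap.curryLeft_add, LinearMap.add_apply, h, h',
        smul_add]
      abel
    | wedge α ω =>
      rw [wedgeAlt_assoc B (q := m + 1) (e₃ := by omega) (e₄ := by omega),
        curryLeft_linForm_wedgeAlt B (k := m) (e' := by omega),
        ih (m := m) (by omega) (by omega) (by omega),
        curryLeft_linForm_wedgeAlt B (e' := by omega), wedgeAlt_sub_left, wedgeAlt_smul_left,
        wedgeAlt_add_right, wedgeAlt_zsmul_right,
        wedgeAlt_assoc B (q := m) (e₃ := by omega) (e₄ := by omega),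
        wedgeAlt_assoc B (q := m) (e₃ := by omega) (e₄ := by omega), pow_succ _ (k + 1),
        mul_neg_one, neg_smul]
      abel

end WedgeFree

/-! ### Lie derivative, Cartan's formula and the Chevalley–Eilenberg formula in low degrees. -/

section Cartan

variable {K A M : Type*} [Field K] [CommRing A] [Algebra K A] [AddCommGroup M] [Module A M]
  {k l m : ℕ}

/-- An operator that is a derivation `D` of `A` together with an endomorphism `g` of `M` acts as a
derivation on products of forms. -/
theorem derivation_wedgeAlt (D : Derivation K A A) (g : M → M) (e : k + l = m)
    (ω : M [⋀^Fin k]→ₗ[A] A) (η : M [⋀^Fin l]→ₗ[A] A) (ω' : M [⋀^Fin k]→ₗ[A] A)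
    (η' : M [⋀^Fin l]→ₗ[A] A)
    (hω : ∀ v, ω' v = D (ω v) - ∑ i, ω (Function.update v i (g (v i))))
    (hη : ∀ v, η' v = D (η v) - ∑ i, η (Function.update v i (g (v i)))) (v : Fin m → M) :
    wedgeAlt e ω' η v + wedgeAlt e ω η' v =
      D (wedgeAlt e ω η v) - ∑ i, wedgeAlt e ω η (Function.update v i (g (v i))) := by
  subst e
  have h : ∀ (ω : M [⋀^Fin k]→ₗ[A] A) (η : M [⋀^Fin l]→ₗ[A] A) (v : Fin (k + l) → M),
      wedgeAlt rfl ω η v = ∑ σ : Equiv.Perm.ModSumCongr (Fin k) (Fin l), LinearMap.mul' A A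
        (AlternatingMap.domCoprod.summand ω η σ fun i => v (finSumFinEquiv i)) := by
    intro ω η v
    rw [wedgeAlt_apply, AlternatingMap.domCoprod'_apply, AlternatingMap.domCoprod_apply,
      sum_apply, map_sum]
    rfl
  -- The product rule for a single way of distributing the arguments over the two factors; the claim
  -- is its signed sum over shuffles.
  have h2 : ∀ w : Fin k ⊕ Fin l → M,
      ω' (fun i => w (Sum.inl i)) * η (fun i => w (Sum.inr i)) +
        ω (fun i => w (Sum.inl i)) * η' (fun i => w (Sum.inr i)) =
      D (ω (fun i => w (Sum.inl i)) * η (fun i => w (Sum.inr i))) -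
        ∑ s, ω (fun i => Function.update w s (g (w s)) (Sum.inl i)) *
          η (fun i => Function.update w s (g (w s)) (Sum.inr i)) := by
    intro w
    have e1 : ∀ (s : Fin k) y, (fun i => Function.update w (Sum.inl s) y (Sum.inl i)) =
        Function.update (fun i => w (Sum.inl i)) s y := fun s y =>
      Function.update_comp_eq_of_injective w Sum.inl_injective s y
    have e2 : ∀ (s : Fin l) y, (fun i => Function.update w (Sum.inr s) y (Sum.inr i)) =
        Function.update (fun i => w (Sum.inr i)) s y := fun s y =>
      Function.update_comp_eq_of_injective w Sum.inr_injective s y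
    simp only [Fintype.sum_sum_type, e1, e2, hω, hη, Derivation.leibniz, sub_mul, mul_sub,
      Finset.sum_mul, Finset.mul_sum, smul_eq_mul, ne_eq, reduceCtorEq, not_false_eq_true,
      Function.update_of_ne]
    ring
  simp only [h, map_sum]
  rw [Finset.sum_comm, ← Finset.sum_sub_distrib, ← Finset.sum_add_distrib]
  refine Finset.sum_congr rfl fun σ _ => ?_
  induction σ using Quotient.inductionOn' with | _ σ => ?_
  have h3 : ∀ (ω : M [⋀^Fin k]→ₗ[A] A) (η : M [⋀^Fin l]→ₗ[A] A) (w : Fin k ⊕ Fin l → M),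
      LinearMap.mul' A A (AlternatingMap.domCoprod.summand ω η (Quotient.mk'' σ) w) =
        (Equiv.Perm.sign σ : ℤ) •
          (ω (fun i => w (σ (Sum.inl i))) * η fun i => w (σ (Sum.inr i))) := by
    intro ω η w
    rw [AlternatingMap.domCoprod.summand_mk'']
    rcases Int.units_eq_one_or (Equiv.Perm.sign σ) with h | h
    · rw [h, one_smul]
      simp
    · rw [h, Units.neg_smul, one_smul]
      simp
  simp only [h3, map_zsmul]
  rw [← smul_add, h2 fun s => v (finSumFinEquiv (σ s)), smul_sub, Finset.smul_sum]
  congr 1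
  -- Changing the argument in position `σ s` and then permuting is the same as permuting and then
  -- changing the argument in position `s`, so the positions are renumbered by `σ`.
  rw [← Equiv.sum_comp (σ.trans finSumFinEquiv)]
  refine Finset.sum_congr rfl fun s _ => ?_
  have h4 : ∀ t, Function.update v (finSumFinEquiv (σ s)) (g (v (finSumFinEquiv (σ s))))
      (finSumFinEquiv (σ t)) = Function.update (fun s => v (finSumFinEquiv (σ s))) s
        (g (v (finSumFinEquiv (σ s)))) t := fun t =>
    congrFun (Function.update_comp_eq_of_injective v (σ.trans finSumFinEquiv).injective s _) t
  simp only [Equiv.trans_apply, h4]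

variable [Module K M] (b : M →ₗ[K] M →ₗ[K] M)
    (a : M →ₗ[A] Derivation K A A)

/-- The Lie derivative of a form. -/
def lieFormula (x : M) (ω : M [⋀^Fin k]→ₗ[A] A) (v : Fin k → M) : A :=
  a x (ω v) - ∑ i, ω (Function.update v i (b x (v i)))

theorem ceFormula_vecCons_zero (ω : M [⋀^Fin 0]→ₗ[A] A) (x : M) (w : Fin 0 → M) :
    ceFormula b a ω (Matrix.vecCons x w) = lieFormula b a x ω w := by
  simp [ceFormula, lieFormula, bracketTerms, Subsingleton.elim _ w]

theorem map_vecCons_swap (ω : M [⋀^Fin (k + 2)]→ₗ[A] A) (x y : M) (w : Fin k → M) :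
    ω (Matrix.vecCons x (Matrix.vecCons y w)) = - ω (Matrix.vecCons y (Matrix.vecCons x w)) := by
  have h := ω.map_insertNth 1 x (Matrix.vecCons y w)
  have h2 : (1 : Fin (k + 2)).insertNth x (Matrix.vecCons y w : Fin (k + 1) → M) =
      Matrix.vecCons y (Matrix.vecCons x w) := by
    refine Fin.insertNth_eq_iff.2 ⟨rfl, ?_⟩
    exact (removeNth_succ_vecCons y (Matrix.vecCons x w) 0).symm
  rw [h2] at h
  simp [h]

/-- Cartan's formula. -/
theorem ceFormula_vecCons (ω : M [⋀^Fin (k + 1)]→ₗ[A] A) (x : M) (w : Fin (k + 1) → M) :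
    ceFormula b a ω (Matrix.vecCons x w) =
      lieFormula b a x ω w - ceFormula b a (ω.curryLeft x) w := by
  have h0 : Finset.Ici (0 : Fin (k + 1)) = Finset.univ := by ext; simp
  have h1 : (0 : Fin (k + 2)).removeNth (Matrix.vecCons x w : Fin (k + 2) → M) = w := by
    ext t; simp [Fin.removeNth]
  -- The pairs of positions containing `0` give the bracket part of the Lie derivative: moving `[x,
  -- w_j]` back to its place costs the sign `(-1)^j`.
  have h2 : ∀ j : Fin (k + 1), ω (Function.update w j (b x (w j))) =
      (-1 : ℤ) ^ (j : ℕ) • ω (Matrix.vecCons (b x (w j)) (j.removeNth w)) := fun j => by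
    rw [← AlternatingMap.map_insertNth, Fin.insertNth_removeNth]
  -- The pairs avoiding position `0`, in which `x` is a spectator. Exchanging `x` with the bracket
  -- in front of it produces the minus sign.
  have h3 : ∑ i : Fin k, ∑ j ∈ Finset.Ici i.succ, (-1 : ℤ) ^ ((i : ℕ) + 1 + (j + 1)) •
      ω (Matrix.vecCons (b (w i.castSucc) (w j))
        (j.removeNth (Matrix.vecCons x (i.castSucc.removeNth w)))) =
      - bracketTerms b (ω.curryLeft x) w := by
    cases k with
    | zero => simp [bracketTerms]
    | succ k =>
      rw [bracketTerms, ← Finset.sum_neg_distrib]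
      refine Finset.sum_congr rfl fun i _ => ?_
      rw [← Fin.map_succEmb_Ici, Finset.sum_map, ← Finset.sum_neg_distrib]
      refine Finset.sum_congr rfl fun j _ => ?_
      rw [Fin.coe_succEmb, removeNth_succ_vecCons, map_vecCons_swap,
        AlternatingMap.curryLeft_apply_apply, smul_neg, Fin.val_succ, ← add_assoc, ← add_assoc,
        ← add_assoc, pow_succ, add_right_comm (i : ℕ) 1, pow_succ _ (i + j + 1)]
      simp
  rw [ceFormula, bracketTerms, Fin.sum_univ_succ (n := k + 1), h1]
  conv_lhs => arg 2; rw [Fin.sum_univ_succ, h0]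
  simp only [removeNth_succ_vecCons, Fin.val_succ,
    Fin.val_zero, pow_zero, one_smul, zero_add, Matrix.cons_val_succ,
    Matrix.cons_val_zero, Fin.castSucc_zero, ← Fin.succ_castSucc, h1, h3]
  simp only [lieFormula, ceFormula, h2, AlternatingMap.curryLeft_apply_apply, pow_succ,
    mul_neg_one, neg_smul, Finset.sum_neg_distrib]
  abel

theorem ceFormula_const (f : A) (v : Fin 1 → M) :
    ceFormula b a (AlternatingMap.constOfIsEmpty A M (Fin 0) f) v = a (v 0) f := by
  simp [ceFormula, bracketTerms]

theorem ceFormula_linForm (α : M →ₗ[A] A) (v : Fin 2 → M) :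
    ceFormula b a (linForm α) v =
      a (v 0) (α (v 1)) - a (v 1) (α (v 0)) - α (b (v 0) (v 1)) := by
  have h0 : Finset.Ici (0 : Fin 1) = Finset.univ := by ext; simp
  simp [ceFormula, bracketTerms, Fin.removeNth, Fin.sum_univ_two, h0]
  ring

/-- Cartan's formula reduces the evaluation to the linear form `ω(x, ·)`. The explicit signs are
needed for the square of the differential on 1-forms. -/
theorem ceFormula_two (ω : M [⋀^Fin 2]→ₗ[A] A) (x y z : M) :
    ceFormula b a ω ![x, y, z] = a x (ω ![y, z]) - ω ![b x y, z] - ω ![y, b x z] -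
      a y (ω ![x, z]) + a z (ω ![x, y]) + ω ![x, b y z] := by
  obtain ⟨α, hα⟩ := exists_eq_linForm (ω.curryLeft x)
  have h : ∀ y, α y = ω ![x, y] := fun y => by
    have := congrArg (fun β => β ![y]) hα
    simpa using this.symm
  have e1 : Function.update ![y, z] 0 (b x y) = ![b x y, z] := by ext i; fin_cases i <;> rfl
  have e2 : Function.update ![y, z] 1 (b x z) = ![y, b x z] := by ext i; fin_cases i <;> rfl
  rw [ceFormula_vecCons, hα, ceFormula_linForm, lieFormula, Fin.sum_univ_two]
  simp only [Matrix.cons_val_zero, Matrix.cons_val_one, h, e1, e2]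
  ring

/-- The left side is `[a x, a y](f) - a([x, y])(f)`, the defect of the anchor as a map of Lie
algebras. -/
theorem ceFormula_ceFormula_const (ha : ∀ x y, a (b x y) = ⁅a x, a y⁆) (f : A)
    (ω : M [⋀^Fin 1]→ₗ[A] A)
    (hω : ∀ v, ω v = ceFormula b a (AlternatingMap.constOfIsEmpty A M (Fin 0) f) v)
    (v : Fin 2 → M) : ceFormula b a ω v = 0 := by
  obtain ⟨α, rfl⟩ := exists_eq_linForm ω
  have h : ∀ y, α y = a y f := fun y => by
    have := hω ![y]
    rw [ceFormula_const] at this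
    simpa using this
  rw [ceFormula_linForm, h, h, h, ha, Derivation.commutator_apply, sub_self]

/-- Since the anchor preserves brackets, all terms in which it occurs cancel, leaving the
Jacobiator. The identity serves in both directions: the Jacobi identity gives `d² = 0`, and `d² = 0`
gives the Jacobi identity back. -/
theorem ceFormula_ceFormula_linForm (hb : ∀ x, b x x = 0) (ha : ∀ x y, a (b x y) = ⁅a x, a y⁆)
    (α : M →ₗ[A] A) (ω : M [⋀^Fin 2]→ₗ[A] A) (hω : ∀ v, ω v = ceFormula b a (linForm α) v)
    (x y z : M) :
    ceFormula b a ω ![x, y, z] = - α (b x (b y z) + b y (b z x) + b z (b x y)) := by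
  have hb' : ∀ x y, b y x = - b x y := fun x y => by
    have h := hb (x + y)
    simp only [map_add, LinearMap.add_apply, hb, zero_add, add_zero] at h
    exact eq_neg_of_add_eq_zero_left h
  rw [ceFormula_two]
  simp only [hω, ceFormula_linForm, Matrix.cons_val_zero, Matrix.cons_val_one, ha,
    Derivation.commutator_apply, map_sub, map_add]
  rw [hb' x z, hb' (b x y) z, map_neg, map_neg, map_neg]
  ring

end Cartan

/-! ### The Chevalley–Eilenberg differential is an antiderivation of square zero. -/

section Leibniz

variable {K A M : Type*} [Field K] [CommRing A] [Algebra K A] [AddCommGroup M] [Module A M]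
  [Module K M] [IsScalarTower K A M] [CharZero K] {k l m : ℕ} (b : M →ₗ[K] M →ₗ[K] M)
  (hb : ∀ x, b x x = 0) (a : M →ₗ[A] Derivation K A A)
  (hL : ∀ x f y, b x (f • y) = f • b x y + a x f • y)

theorem ceDiff_add (ω η : M [⋀^Fin k]→ₗ[A] A) :
    ceDiff b hb a hL (ω + η) = ceDiff b hb a hL ω + ceDiff b hb a hL η :=
  AlternatingMap.ext fun v => ceFormula_add b a ω η v

/-- The Chevalley–Eilenberg differential as an additive map. -/
def ceDiffHom (k : ℕ) : (M [⋀^Fin k]→ₗ[A] A) →+ M [⋀^Fin (k + 1)]→ₗ[A] A :=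
  AddMonoidHom.mk' (ceDiff b hb a hL) (ceDiff_add b hb a hL)

theorem ceDiff_zsmul (z : ℤ) (ω : M [⋀^Fin k]→ₗ[A] A) :
    ceDiff b hb a hL (z • ω) = z • ceDiff b hb a hL ω :=
  map_zsmul (ceDiffHom b hb a hL k) z ω

/-- The Lie derivative of a form. -/
def lieAlt (x : M) : ∀ {k : ℕ}, (M [⋀^Fin k]→ₗ[A] A) → M [⋀^Fin k]→ₗ[A] A
  | 0, ω => (ceDiff b hb a hL ω).curryLeft x
  | _ + 1, ω => (ceDiff b hb a hL ω).curryLeft x + ceDiff b hb a hL (ω.curryLeft x)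

/-- Defining the Lie derivative as `ι_x d + d ι_x` makes its `A`-multilinearity automatic, whereas
the explicit formula hides it; Cartan's formula says that the two agree. -/
theorem lieAlt_apply (x : M) (ω : M [⋀^Fin k]→ₗ[A] A) (v : Fin k → M) :
    lieAlt b hb a hL x ω v = lieFormula b a x ω v := by
  cases k with
  | zero => exact ceFormula_vecCons_zero b a ω x v
  | succ k =>
    rw [lieAlt, AlternatingMap.add_apply, AlternatingMap.curryLeft_apply_apply, ceDiff_apply,
      ceDiff_apply, ceFormula_vecCons, sub_add_cancel]

theorem curryLeft_ceDiff (x : M) (ω : M [⋀^Fin (k + 1)]→ₗ[A] A) :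
    (ceDiff b hb a hL ω).curryLeft x = lieAlt b hb a hL x ω - ceDiff b hb a hL (ω.curryLeft x) :=
  (add_sub_cancel_right _ _).symm

theorem lieAlt_wedgeAlt (e : k + l = m) (x : M) (ω : M [⋀^Fin k]→ₗ[A] A)
    (η : M [⋀^Fin l]→ₗ[A] A) : lieAlt b hb a hL x (wedgeAlt e ω η) =
      wedgeAlt e (lieAlt b hb a hL x ω) η + wedgeAlt e ω (lieAlt b hb a hL x η) := by
  ext v
  rw [lieAlt_apply, AlternatingMap.add_apply]
  exact (derivation_wedgeAlt (a x) (b x) e ω η _ _ (lieAlt_apply b hb a hL x ω)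
    (lieAlt_apply b hb a hL x η) v).symm

omit [Algebra K A] [IsScalarTower K A M] [CharZero K] in
theorem bracketTerms_smul (f : A) (ω : M [⋀^Fin k]→ₗ[A] A) (v : Fin (k + 1) → M) :
    bracketTerms b (f • ω) v = f * bracketTerms b ω v := by
  cases k with
  | zero => simp [bracketTerms]
  | succ k =>
    simp only [bracketTerms, Finset.mul_sum, AlternatingMap.smul_apply, mul_smul_comm, smul_eq_mul]

/-- The linear form `x ↦ a(x)(f)`. -/
def anchorDual (f : A) : M →ₗ[A] A where
  toFun x := a x f
  map_add' x y := by rw [map_add, Derivation.add_apply]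
  map_smul' g x := by rw [map_smul, Derivation.smul_apply]; rfl

theorem ceDiff_const (f : A) : ceDiff b hb a hL (AlternatingMap.constOfIsEmpty A M (Fin 0) f) =
    linForm (anchorDual a f) :=
  AlternatingMap.ext fun v => ceFormula_const b a f v

variable {n : ℕ} (B : Module.Basis (Fin n) A M)

theorem curryLeft_ext {ω η : M [⋀^Fin (k + 1)]→ₗ[A] A}
    (h : ∀ x, ω.curryLeft x = η.curryLeft x) : ω = η := by
  ext v
  rw [← Matrix.cons_head_tail v]
  exact congrArg (fun θ => θ (Matrix.vecTail v)) (h (Matrix.vecHead v))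

-- The bracket terms are `A`-linear in the form, so `f` is differentiated only in the anchor terms.
-- These contribute the expansion of `df ∧ η` along its first factor.
include B in
theorem ceDiff_smul (e : 1 + k = k + 1) (f : A) (η : M [⋀^Fin k]→ₗ[A] A) :
    ceDiff b hb a hL (f • η) =
      wedgeAlt e (linForm (anchorDual a f)) η + f • ceDiff b hb a hL η := by
  ext v
  rw [AlternatingMap.add_apply, AlternatingMap.smul_apply, linForm_wedgeAlt_apply B, ceDiff_apply,
    ceDiff_apply, ceFormula, ceFormula, bracketTerms_smul, smul_eq_mul, mul_add, ← add_assoc,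
    Finset.mul_sum, ← Finset.sum_add_distrib]
  congr 1
  refine Finset.sum_congr rfl fun i _ => ?_
  rw [AlternatingMap.smul_apply, smul_eq_mul, Derivation.leibniz, mul_smul_comm, ← smul_add]
  simp only [smul_eq_mul, anchorDual, LinearMap.coe_mk, AddHom.coe_mk]
  congr 1
  ring

theorem curryLeft_zsmul (z : ℤ) (ω : M [⋀^Fin (k + 1)]→ₗ[A] A) (x : M) :
    (z • ω).curryLeft x = z • ω.curryLeft x := rfl

include B in
theorem curryLeft_wedgeAlt_zero (e : k + 1 + 0 = k + 1) (e' : k + 0 = k)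
    (ω : M [⋀^Fin (k + 1)]→ₗ[A] A) (η : M [⋀^Fin 0]→ₗ[A] A) (x : M) :
    (wedgeAlt e ω η).curryLeft x = wedgeAlt e' (ω.curryLeft x) η := by
  rw [exists_eq_const η, wedgeAlt_const_right B, wedgeAlt_const_right B,
    AlternatingMap.curryLeft_smul, LinearMap.smul_apply]

include B in
/-- The Chevalley–Eilenberg differential is an antiderivation. -/
theorem ceDiff_wedgeAlt (e : k + l = m) (e₁ : k + 1 + l = m + 1) (e₂ : k + (l + 1) = m + 1)
    (ω : M [⋀^Fin k]→ₗ[A] A) (η : M [⋀^Fin l]→ₗ[A] A) :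
    ceDiff b hb a hL (wedgeAlt e ω η) = wedgeAlt e₁ (ceDiff b hb a hL ω) η +
      (-1 : ℤ) ^ k • wedgeAlt e₂ ω (ceDiff b hb a hL η) := by
  -- Induction on the total degree. A form of positive degree is determined by its contractions, and
  -- `ι_x d = L_x - d ι_x` reduces the contracted identity to lower degree.
  induction m generalizing k l with
  | zero =>
    obtain ⟨rfl, rfl⟩ : k = 0 ∧ l = 0 := by omega
    rw [exists_eq_const ω, wedgeAlt_const_left B, wedgeAlt_const_left B,
      ceDiff_smul b hb a hL B e₁, ceDiff_const, pow_zero, one_smul]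
  | succ m ih =>
    cases k with
    | zero =>
      obtain rfl : l = m + 1 := by omega
      rw [exists_eq_const ω, wedgeAlt_const_left B, wedgeAlt_const_left B,
        ceDiff_smul b hb a hL B e₁, ceDiff_const, pow_zero, one_smul]
    | succ k =>
      refine curryLeft_ext fun x => ?_
      rw [curryLeft_ceDiff, lieAlt_wedgeAlt, AlternatingMap.curryLeft_add,
        LinearMap.add_apply, curryLeft_zsmul,
        curryLeft_wedgeAlt B e₂ (by omega) (by omega)]
      -- The case `l = 0` is separate because a function has no contraction: the corresponding term
      -- is absent, and `L_x η` is just `ι_x dη`.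
      cases l with
      | zero =>
        obtain rfl : k = m := by omega
        rw [curryLeft_wedgeAlt_zero B e (by omega), curryLeft_wedgeAlt_zero B e₁ (by omega),
          ih (by omega) (by omega) (by omega), curryLeft_ceDiff]
        have h0 : lieAlt b hb a hL x η = (ceDiff b hb a hL η).curryLeft x := rfl
        rw [h0]
        rcases neg_one_pow_eq_or ℤ k with h | h <;>
        simp only [pow_succ, h, wedgeAlt_sub_left] <;> simp <;> abel
      | succ l =>
        rw [curryLeft_wedgeAlt B e (by omega) (by omega), ceDiff_add, ceDiff_zsmul,
          curryLeft_wedgeAlt B e₁ (by omega) (by omega), curryLeft_ceDiff, curryLeft_ceDiff,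
          ih (by omega) (by omega) (by omega), ih (by omega) (by omega) (by omega)]
        rcases neg_one_pow_eq_or ℤ k with h | h <;>
        simp only [pow_succ, h, wedgeAlt_sub_left, wedgeAlt_sub_right] <;> simp <;> abel

include B in
/-- The Chevalley–Eilenberg differential of a Lie–Rinehart algebra squares to zero. -/
theorem ceDiff_ceDiff (ha : ∀ x y, a (b x y) = ⁅a x, a y⁆)
    (hJ : ∀ x y z, b x (b y z) + b y (b z x) + b z (b x y) = 0) (ω : M [⋀^Fin k]→ₗ[A] A) :
    ceDiff b hb a hL (ceDiff b hb a hL ω) = 0 := by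
  induction k with
  | zero =>
    rw [exists_eq_const ω]
    exact AlternatingMap.ext (ceFormula_ceFormula_const b a ha _ _ fun _ => rfl)
  | succ k ih =>
    -- In `d²(α ∧ η)` the two cross terms `dα ∧ dη` have opposite signs, so only `d²α ∧ η` and `α ∧
    -- d²η` are left; the first vanishes by the Jacobi identity, the second by induction.
    induction ω using alternating_induction_succ B with
    | add ω η h h' => rw [ceDiff_add, ceDiff_add, h, h', add_zero]
    | wedge α η =>
      have h : ceDiff b hb a hL (ceDiff b hb a hL (linForm α)) = 0 := by
        ext v
        have hv : v = ![v 0, v 1, v 2] := by ext i; fin_cases i <;> rfl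
        rw [hv, ceDiff_apply, ceFormula_ceFormula_linForm b a hb ha α _ fun _ => rfl, hJ, map_zero,
          neg_zero, AlternatingMap.zero_apply]
      rw [ceDiff_wedgeAlt b hb a hL B _ (by omega) (by omega), ceDiff_add, ceDiff_zsmul,
        ceDiff_wedgeAlt b hb a hL B _ (by omega) (by omega),
        ceDiff_wedgeAlt b hb a hL B _ (by omega) (by omega), h, ih]
      have e1 : ∀ {p q r : ℕ} (e : p + q = r) (η : M [⋀^Fin q]→ₗ[A] A),
        wedgeAlt e 0 η = 0 := fun e η => map_zero ((wedgeₗ e).flip η)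
      have e2 : ∀ {p q r : ℕ} (e : p + q = r) (ω : M [⋀^Fin p]→ₗ[A] A),
        wedgeAlt e ω 0 = 0 := fun e ω => map_zero (wedgeₗ e ω)
      simp [e1, e2]

end Leibniz
end LieRinehart

namespace TopRingedSpace

variable {K : Type u} [Field K] [TopologicalSpace K] {X : TopCat.{u}} {O : TopRingedSpace K X}

/-! ### Sections and forms are determined locally -/

theorem sec_eq_of_locally {U : Opens X} {f g : O.sec U}
    (h : ∀ x ∈ U, ∃ V : Opens X, ∃ hV : V ≤ U, x ∈ V ∧ O.res hV f = O.res hV g) : f = g := by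
  refine Subtype.ext (funext fun x => ?_)
  obtain ⟨V, hV, hx, e⟩ := h x x.2
  exact congrFun (congrArg Subtype.val e) ⟨x, hx⟩

theorem Sec.eq_of_locally (E : Mod O) {U : Opens X} {s t : Sec E U}
    (h : ∀ x ∈ U, ∃ V : Opens X, ∃ hV : V ≤ U, x ∈ V ∧ Sec.res E hV s = Sec.res E hV t) :
    s = t := by
  choose V hV hx e using h
  refine TopCat.Sheaf.eq_of_locally_eq' (⟨E.val.presheaf, E.isSheaf⟩ : TopCat.Sheaf AddCommGrpCat X)
    (fun x : U => V x x.2) U (fun x => homOfLE (hV x x.2)) (fun x hxU => ?_) s t fun x => e x x.2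
  exact Opens.mem_iSup.2 ⟨⟨x, hxU⟩, hx x hxU⟩

theorem Sec.exists_gluing (E : Mod O) {U : Opens X} (V : U → Opens X) (hV : ∀ x, V x ≤ U)
    (hx : ∀ x : U, (x : X) ∈ V x) (s : ∀ x, Sec E (V x))
    (hs : ∀ x y, Sec.res E (inf_le_left : V x ⊓ V y ≤ V x) (s x) =
      Sec.res E (inf_le_right : V x ⊓ V y ≤ V y) (s y)) :
    ∃ t : Sec E U, ∀ x, Sec.res E (hV x) t = s x := by
  obtain ⟨t, ht, -⟩ := TopCat.Sheaf.existsUnique_gluing'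
    (⟨E.val.presheaf, E.isSheaf⟩ : TopCat.Sheaf AddCommGrpCat X) V U (fun x => homOfLE (hV x))
    (fun x hxU => Opens.mem_iSup.2 ⟨⟨x, hxU⟩, hx ⟨x, hxU⟩⟩) (sf := s) fun x y => hs x y
  exact ⟨t, ht⟩

theorem Sec.res_self (E : Mod O) {U : Opens X} (s : Sec E U) : Sec.res E le_rfl s = s := by
  exact congrArg (fun f => f.hom s) (E.val.presheaf.map_id (op U))

theorem Form.eq_of_locally {E : Mod O} {k : ℕ} {U : Opens X} {ω η : Form E k U}
    (h : ∀ x ∈ U, ∃ V : Opens X, ∃ hV : V ≤ U, x ∈ V ∧ Form.res hV ω = Form.res hV η) : ω = η := by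
  refine Form.ext fun W hW v => sec_eq_of_locally fun x hx => ?_
  obtain ⟨V, hV, hxV, e⟩ := h x (hW hx)
  refine ⟨V ⊓ W, inf_le_right, ⟨hxV, hx⟩, ?_⟩
  rw [Form.eval_res, Form.eval_res]
  exact congrArg (fun θ : Form E k V => θ.eval (V ⊓ W) inf_le_left
    fun i => Sec.res E inf_le_right (v i)) e

/-- Morphisms of `O`-modules from compatible families of linear maps. -/
def homMk {E F : Mod O} (g : ∀ U : Opens X, Sec E U →ₗ[O.sec U] Sec F U)
    (hg : ∀ {U V : Opens X} (h : V ≤ U) (s : Sec E U),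
      g V (Sec.res E h s) = Sec.res F h (g U s)) : E ⟶ F where
  val :=
    { app := fun U => ModuleCat.ofHom (X := E.val.obj U) (Y := F.val.obj U) (g U.unop)
      naturality := fun {U V} f => by
        ext s
        exact hg (leOfHom f.unop) s }

theorem hom_ext {E F : Mod O} {φ φ' : E ⟶ F} (h : ∀ U s, homApp φ U s = homApp φ' U s) :
    φ = φ' := by
  ext U s
  exact h U.unop s

end TopRingedSpace

/-! ### Linear maps out of exterior powers, tested on decomposable elements. -/

namespace LieRinehart

variable {A N P Q R : Type*} [CommRing A] [AddCommGroup N] [Module A N] [AddCommGroup P]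
  [Module A P] [AddCommGroup Q] [Module A Q] [AddCommGroup R] [Module A R] {k l : ℕ}

theorem exteriorPower_induction {p : ⋀[A]^k N → Prop} (add : ∀ s t, p s → p t → p (s + t))
    (smul : ∀ (f : A) (α : Fin k → N), p (f • exteriorPower.ιMulti A k α)) (t) : p t := by
  have ht : t ∈ Submodule.span A (Set.range (exteriorPower.ιMulti A k (M := N))) := by
    rw [exteriorPower.ιMulti_span]; trivial
  induction ht using Submodule.closure_induction with
  | zero =>
    rw [← zero_smul A (exteriorPower.ιMulti A k 0)]
    exact smul _ _
  | add x y _ _ hx hy => exact add _ _ hx hy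
  | smul_mem f x hx =>
    obtain ⟨α, rfl⟩ := hx
    exact smul _ _

theorem exteriorPower_range_induction {f : ⋀[A]^k N →ₗ[A] P} (hf : Function.Surjective f)
    {p : P → Prop} (add : ∀ s t, p s → p t → p (s + t))
    (smul : ∀ (a : A) (α : Fin k → N), p (a • f (exteriorPower.ιMulti A k α))) (t) : p t := by
  obtain ⟨t, rfl⟩ := hf t
  induction t using exteriorPower_induction with
  | add s t h h' => rw [map_add]; exact add _ _ h h'
  | smul a α => rw [map_smul]; exact smul a α

theorem ιMulti_mul_ιMulti (α : Fin k → N) (β : Fin l → N) :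
    ExteriorAlgebra.ιMulti A k α * ExteriorAlgebra.ιMulti A l β =
      ExteriorAlgebra.ιMulti A (k + l) (Fin.append α β) := by
  rw [ExteriorAlgebra.ιMulti_apply, ExteriorAlgebra.ιMulti_apply,
    ExteriorAlgebra.ιMulti_apply, ← List.prod_append, ← List.ofFn_fin_append]
  congr 2
  funext i
  refine Fin.addCases (fun i => ?_) (fun i => ?_) i
  · simp
  · simp

/-- Both sides are bilinear, so multiplicativity need only be known on decomposable elements, whose
product is given by concatenation. -/
theorem map_exteriorPower_mul (f : ⋀[A]^k N →ₗ[A] P) (g : ⋀[A]^l N →ₗ[A] Q)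
    (h : ⋀[A]^(k + l) N →ₗ[A] R) (w : P →ₗ[A] Q →ₗ[A] R)
    (hw : ∀ α β, h (exteriorPower.ιMulti A (k + l) (Fin.append α β)) =
      w (f (exteriorPower.ιMulti A k α)) (g (exteriorPower.ιMulti A l β)))
    (s : ⋀[A]^k N) (t : ⋀[A]^l N) :
    h ⟨s.1 * t.1, SetLike.mul_mem_graded s.2 t.2⟩ = w (f s) (g t) := by
  let μ (s : ⋀[A]^k N) (t : ⋀[A]^l N) : ⋀[A]^(k + l) N :=
    ⟨s.1 * t.1, SetLike.mul_mem_graded s.2 t.2⟩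
  have h1 : ∀ s s' t, μ (s + s') t = μ s t + μ s' t := fun s s' t => Subtype.ext (add_mul _ _ _)
  have h2 : ∀ s t t', μ s (t + t') = μ s t + μ s t' := fun s t t' => Subtype.ext (mul_add _ _ _)
  have h3 : ∀ (a : A) s t, μ (a • s) t = a • μ s t := fun a s t =>
    Subtype.ext (smul_mul_assoc a s.1 t.1)
  have h4 : ∀ (a : A) s t, μ s (a • t) = a • μ s t := fun a s t =>
    Subtype.ext (mul_smul_comm a s.1 t.1)
  change h (μ s t) = _
  induction s using exteriorPower_induction with
  | add s s' h h' => rw [h1, map_add, h, h', map_add, map_add, LinearMap.add_apply]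
  | smul a α =>
    induction t using exteriorPower_induction with
    | add s s' h h' => rw [h2, map_add, h, h', map_add, map_add]
    | smul c β =>
      have h5 : μ (exteriorPower.ιMulti _ k α) (exteriorPower.ιMulti _ l β) =
          exteriorPower.ιMulti _ (k + l) (Fin.append α β) := Subtype.ext (ιMulti_mul_ιMulti α β)
      rw [h3, h4, h5, map_smul, map_smul, map_smul, map_smul, map_smul, LinearMap.smul_apply,
        map_smul, hw]

theorem exteriorPower_map_bijective {f : N →ₗ[A] P} (hf : Function.Bijective f) :
    Function.Bijective (exteriorPower.map k f) := by
  let e := LinearEquiv.ofBijective f hf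
  refine ⟨Function.LeftInverse.injective (g := exteriorPower.map k e.symm.toLinearMap) fun t => ?_,
    exteriorPower.map_surjective hf.2⟩
  rw [← LinearMap.comp_apply, ← exteriorPower.map_comp,
    show e.symm.toLinearMap ∘ₗ f = LinearMap.id from LinearMap.ext e.symm_apply_apply,
    exteriorPower.map_id, LinearMap.id_apply]

/-- Used with `N` the module of sheaf 1-forms and `g` their evaluation on sections over `U`: it
carries the purely algebraic isomorphism over to the sheaf of forms. -/
theorem detFormLinear_map {M : Type*} [AddCommGroup M] [Module A M] (f : ⋀[A]^k N →ₗ[A] P)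
    (g : N →ₗ[A] Module.Dual A M) (q : P →ₗ[A] M [⋀^Fin k]→ₗ[A] A)
    (h : ∀ α, q (f (exteriorPower.ιMulti A k α)) = detForm fun i => g (α i)) (t : ⋀[A]^k N) :
    q (f t) = detFormLinear A M k (exteriorPower.map k g t) := by
  induction t using exteriorPower_induction with
  | add s t h h' => simp only [map_add, h, h']
  | smul a α =>
    rw [map_smul, map_smul, map_smul, map_smul, exteriorPower.map_apply_ιMulti,
      detFormLinear_ιMulti, h]
    rfl

end LieRinehart

namespace TopRingedSpace

variable {K : Type u} [Field K] [TopologicalSpace K] {X : TopCat.{u}} {O : TopRingedSpace K X}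

open LieRinehart

/-! ### Frames -/

/-- A frame of `E` over `U`: compatible bases of the modules of sections over all `V ⊆ U`. -/
structure Frame (E : Mod O) (U : Opens X) (n : ℕ) where
  basis (V : Opens X) (hV : V ≤ U) : Module.Basis (Fin n) (O.sec V) (Sec E V)
  coord_res {V W : Opens X} (hV : V ≤ U) (h : W ≤ V) (s : Sec E V) (i : Fin n) :
    (basis W (h.trans hV)).coord i (Sec.res E h s) = O.res h ((basis V hV).coord i s)

theorem IsLocallyFreeOfFiniteRank.exists_frame {E : Mod O} (hE : IsLocallyFreeOfFiniteRank E)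
    (x : X) : ∃ U : Opens X, x ∈ U ∧ ∃ n, Nonempty (Frame E U n) := by
  obtain ⟨U, hx, n, e, he⟩ := hE x
  refine ⟨U, hx, n, ⟨⟨fun V hV => Module.Basis.ofEquivFun (e V hV), fun hV h s i => ?_⟩⟩⟩
  rw [Module.Basis.coord_apply, Module.Basis.coord_apply, Module.Basis.ofEquivFun_repr_apply,
    Module.Basis.ofEquivFun_repr_apply, he _ _ hV h]

namespace Frame

variable {E : Mod O} {U : Opens X} {n : ℕ} (F : Frame E U n)

/-- Restriction of a frame. -/
def res {V : Opens X} (h : V ≤ U) : Frame E V n where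
  basis W hW := F.basis W (hW.trans h)
  coord_res hV hW s i := F.coord_res (hV.trans h) hW s i

theorem res_basis {V W : Opens X} (hV : V ≤ U) (h : W ≤ V) (i : Fin n) :
    Sec.res E h (F.basis V hV i) = F.basis W (h.trans hV) i := by
  refine (F.basis W (h.trans hV)).ext_elem fun j => ?_
  rw [← Module.Basis.coord_apply, F.coord_res hV h, Module.Basis.coord_apply,
    Module.Basis.repr_self, Module.Basis.repr_self, Finsupp.single_apply, Finsupp.single_apply,
    apply_ite (O.res h), map_one, map_zero]

/-- The coordinate forms of a frame. -/
def coordForm (i : Fin n) : Form E 1 U :=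
  Form.ofCompatible (fun V hV => linForm ((F.basis V hV).coord i))
    fun _ _ hV h v => (F.coord_res hV h (v 0) i).symm

-- A form over `U` is a family indexed by all `V ⊆ U`. Over `V` it is determined by its values on
-- the basis, and these are restrictions of its values on the basis over `U`. Identities of forms
-- over a frame therefore become identities of alternating maps on one free module.
include F in
theorem eval_injective {k : ℕ} :
    Function.Injective fun ω : Form E k U => ω.eval U le_rfl := by
  intro ω η h
  refine Form.ext fun V hV v => ?_
  congr 1
  refine (F.basis V hV).ext_alternating fun i _ => ?_
  have e : ∀ θ : Form E k U, θ.eval V hV (fun j => F.basis V hV (i j)) =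
      O.res hV (θ.eval U le_rfl fun j => F.basis U le_rfl (i j)) := fun θ => by
    rw [Form.eval_res]
    simp only [F.res_basis]
  rw [e, e]
  exact congrArg (fun θ : (Sec E U) [⋀^Fin k]→ₗ[O.sec U] O.sec U =>
    O.res hV (θ fun j => F.basis U le_rfl (i j))) h

/-- A linear form on the sections over `U` as a `1`-form. -/
def ofLin (α : Sec E U →ₗ[O.sec U] O.sec U) : Form E 1 U :=
  ∑ i, α (F.basis U le_rfl i) • F.coordForm i

end Frame

/-! ### Forms over an open set with a frame, and their identification with the exterior algebra. -/

namespace Form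

variable {E : Mod O} {U : Opens X} {n k l m : ℕ}

/-- The alternating map on sections over `U` that belongs to a form over `U`. -/
def evalₗ (E : Mod O) (k : ℕ) (U : Opens X) :
    Form E k U →ₗ[O.sec U] (Sec E U) [⋀^Fin k]→ₗ[O.sec U] O.sec U where
  toFun ω := ω.eval U le_rfl
  map_add' _ _ := rfl
  map_smul' _ _ := rfl

/-- `1`-forms as linear forms on sections. -/
def toDual (E : Mod O) (U : Opens X) :
    Form E 1 U →ₗ[O.sec U] Module.Dual (O.sec U) (Sec E U) where
  toFun α := α.toLin U le_rfl
  map_add' _ _ := rfl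
  map_smul' _ _ := rfl

theorem linForm_toLin (α : Form E 1 U) (V : Opens X) (hV : V ≤ U) :
    α.eval V hV = linForm (α.toLin V hV) :=
  ((AlternatingMap.ofSubsingleton _ _ _ (0 : Fin 1)).apply_symm_apply (α.eval V hV)).symm

theorem toDual_bijective (F : Frame E U n) : Function.Bijective (toDual E U) := by
  constructor
  · intro α β h
    refine F.eval_injective ?_
    change α.eval U le_rfl = β.eval U le_rfl
    rw [linForm_toLin, linForm_toLin]
    exact congrArg linForm h
  · intro α
    refine ⟨F.ofLin α, (F.basis U le_rfl).ext fun j => ?_⟩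
    rw [Frame.ofLin, map_sum, LinearMap.sum_apply]
    simp only [map_smul, LinearMap.smul_apply]
    have h : ∀ i, toDual E U (F.coordForm i) (F.basis U le_rfl j) = if j = i then 1 else 0 :=
      fun i => by
        refine Eq.trans (?_ : _ = (F.basis U le_rfl).coord i (F.basis U le_rfl j)) ?_
        · rfl
        · rw [Module.Basis.coord_apply, Module.Basis.repr_self, Finsupp.single_apply]
    simp [h]

theorem ofExteriorPower_ιMulti (α : Fin k → Form E 1 U) :
    ofExteriorPower E k U (exteriorPower.ιMulti _ k α) = wedgeOne α :=
  exteriorPower.alternatingMapLinearEquiv_apply_ιMulti _ _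

theorem eval_ofExteriorPower (t : ⋀[O.sec U]^k (Form E 1 U)) :
    (ofExteriorPower E k U t).eval U le_rfl =
      detFormLinear (O.sec U) (Sec E U) k (exteriorPower.map k (toDual E U) t) := by
  refine detFormLinear_map _ (toDual E U) (evalₗ E k U) (fun α => ?_) t
  rw [ofExteriorPower_ιMulti]
  rfl

/-- After evaluation over `U` the map is a composition of two bijections, from `⋀^k` of the 1-forms
to `⋀^k` of the dual module and on to the alternating maps. Injectivity of evaluation removes it
again. -/
theorem ofExteriorPower_bijective (F : Frame E U n) :
    Function.Bijective (ofExteriorPower E k U) := by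
  have h : Function.Bijective fun t => (ofExteriorPower E k U t).eval U le_rfl := by
    simp only [eval_ofExteriorPower]
    exact (detFormLinear_bijective (F.basis U le_rfl)).comp
      (exteriorPower_map_bijective (toDual_bijective F))
  refine ⟨fun s t hst => h.1 (congrArg (fun ω : Form E k U => ω.eval U le_rfl) hst), fun ω => ?_⟩
  obtain ⟨t, ht⟩ := h.2 (ω.eval U le_rfl)
  exact ⟨t, F.eval_injective ht⟩

theorem wedge_eval (e : k + l = m) (ω : Form E k U) (η : Form E l U) (V : Opens X) (hV : V ≤ U) :
    (wedge e ω η).eval V hV = wedgeAlt e (ω.eval V hV) (η.eval V hV) := rfl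

theorem wedgeOne_eval (α : Fin k → Form E 1 U) (V : Opens X) (hV : V ≤ U) :
    (wedgeOne α).eval V hV = detForm fun j => (α j).toLin V hV := rfl

theorem ofFun_eval (f : O.sec U) (V : Opens X) (hV : V ≤ U) :
    (ofFun f : Form E 0 U).eval V hV =
      AlternatingMap.constOfIsEmpty (O.sec V) (Sec E V) (Fin 0) (O.res hV f) := rfl

theorem wedge_wedgeOne (α : Fin k → Form E 1 U) (β : Fin l → Form E 1 U) :
    wedge rfl (wedgeOne α) (wedgeOne β) = wedgeOne (Fin.append α β) := by
  refine Form.ext fun V hV v => ?_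
  rw [wedge_eval, wedgeOne_eval, wedgeOne_eval, wedgeAlt_detForm, wedgeOne_eval]
  congr 2
  funext i
  refine Fin.addCases (fun i => ?_) (fun i => ?_) i
  · simp
  · simp

theorem wedge_add_left (e : k + l = m) (ω ω' : Form E k U) (η : Form E l U) :
    wedge e (ω + ω') η = wedge e ω η + wedge e ω' η :=
  Form.ext fun V hV v => by
    simp only [wedge_eval, add_eval, wedgeAlt_add_left]

theorem wedge_add_right (e : k + l = m) (ω : Form E k U) (η η' : Form E l U) :
    wedge e ω (η + η') = wedge e ω η + wedge e ω η' :=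
  Form.ext fun V hV v => by
    simp only [wedge_eval, add_eval, wedgeAlt_add_right]

theorem wedge_smul_left (e : k + l = m) (f : O.sec U) (ω : Form E k U) (η : Form E l U) :
    wedge e (f • ω) η = f • wedge e ω η :=
  Form.ext fun V hV v => by
    simp only [wedge_eval, smul_eval, wedgeAlt_smul_left]

theorem wedge_smul_right (e : k + l = m) (f : O.sec U) (ω : Form E k U) (η : Form E l U) :
    wedge e ω (f • η) = f • wedge e ω η :=
  Form.ext fun V hV v => by
    simp only [wedge_eval, smul_eval, wedgeAlt_smul_right]

/-- The wedge product of forms as a bilinear map. -/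
def wedgeBilin (e : k + l = m) : Form E k U →ₗ[O.sec U] Form E l U →ₗ[O.sec U] Form E m U :=
  LinearMap.mk₂ (O.sec U) (wedge e) (wedge_add_left e) (wedge_smul_left e) (wedge_add_right e)
    fun f ω η => wedge_smul_right e f ω η

theorem ofExteriorPower_mul (s : ⋀[O.sec U]^k (Form E 1 U)) (t : ⋀[O.sec U]^l (Form E 1 U)) :
    ofExteriorPower E (k + l) U ⟨s.1 * t.1, SetLike.mul_mem_graded s.2 t.2⟩ =
      wedge rfl (ofExteriorPower E k U s) (ofExteriorPower E l U t) := by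
  refine map_exteriorPower_mul _ _ _ (wedgeBilin rfl) (fun α β => ?_) s t
  rw [ofExteriorPower_ιMulti, ofExteriorPower_ιMulti, ofExteriorPower_ιMulti, ← wedge_wedgeOne]
  rfl

/-- Over an open set with a frame, every form of positive degree is a sum of products with
`1`-forms. -/
theorem induction_succ (F : Frame E U n) {p : Form E (k + 1) U → Prop}
    (add : ∀ ω η, p ω → p η → p (ω + η))
    (wedge : ∀ (α : Form E 1 U) (η : Form E k U), p (wedge (Nat.add_comm 1 k) α η))
    (ω : Form E (k + 1) U) : p ω := by
  refine exteriorPower_range_induction (ofExteriorPower_bijective F).2 add (fun f α => ?_) ω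
  rw [ofExteriorPower_ιMulti]
  convert wedge (α 0) (f • wedgeOne (Matrix.vecTail α)) using 1
  rw [wedge_smul_right]
  congr 1
  refine Form.ext fun V hV v => ?_
  rw [wedge_eval, wedgeOne_eval, wedgeOne_eval, linForm_toLin, ← detForm_vecCons]
  congr 2
  funext i
  refine Fin.cases ?_ (fun i => ?_) i <;> rfl

theorem exists_eq_ofFun (ω : Form E 0 U) : ∃ f, ω = ofFun f := by
  refine ⟨ω.eval U le_rfl Fin.elim0, Form.ext fun V hV v => ?_⟩
  rw [ofFun_eval, eval_res]
  exact congrArg _ (Subsingleton.elim _ _)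

end Form

theorem formsAreExteriorAlgebra {E : Mod O} (hE : IsLocallyFreeOfFiniteRank E) :
    FormsAreExteriorAlgebra E where
  mul _ _ _ := Form.ofExteriorPower_mul
  bijective k x := by
    obtain ⟨U, hx, n, ⟨F⟩⟩ := hE.exists_frame x
    exact ⟨U, hx, fun V hV => Form.ofExteriorPower_bijective (F.res hV)⟩

section

variable {E : Mod O} {k l m : ℕ} {U : Opens X}

theorem Form.eq_of_frames (hE : IsLocallyFreeOfFiniteRank E) {F : Mod O} {ω η : Form F k U}
    (h : ∀ (V : Opens X) (hV : V ≤ U) (n : ℕ), Frame E V n → Form.res hV ω = Form.res hV η) :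
    ω = η := by
  refine Form.eq_of_locally fun x hx => ?_
  obtain ⟨V, hxV, n, ⟨F⟩⟩ := hE.exists_frame x
  exact ⟨V ⊓ U, inf_le_right, ⟨hxV, hx⟩, h _ _ n (F.res inf_le_left)⟩

theorem Form.wedge_ofFun_left (hE : IsLocallyFreeOfFiniteRank E) (e : 0 + k = k) (f : O.sec U)
    (η : Form E k U) : Form.wedge e (Form.ofFun f) η = f • η := by
  refine Form.eq_of_frames hE fun V hV n F => F.eval_injective ?_
  exact wedgeAlt_const_left (F.basis V le_rfl) e (O.res hV f) (η.eval V hV)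

theorem Form.wedge_ofFun_right (hE : IsLocallyFreeOfFiniteRank E) (e : k + 0 = k) (f : O.sec U)
    (η : Form E k U) : Form.wedge e η (Form.ofFun f) = f • η := by
  refine Form.eq_of_frames hE fun V hV n F => F.eval_injective ?_
  exact wedgeAlt_const_right (F.basis V le_rfl) e (O.res hV f) (η.eval V hV)

theorem Form.zsmul_eval (z : ℤ) (ω : Form E k U) (V : Opens X) (hV : V ≤ U) :
    (z • ω).eval V hV = z • ω.eval V hV :=
  map_zsmul (AddMonoidHom.mk' (fun ω : Form E k U => ω.eval V hV) fun _ _ => rfl) z ω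

theorem IsDGA.leibniz_cast {d : FormOperator E} (hd : IsDGA d) (e : k + l = m)
    (e₁ : k + 1 + l = m + 1) (e₂ : k + (l + 1) = m + 1) (ω : Form E k U) (η : Form E l U) :
    d.app m U (Form.wedge e ω η) = Form.wedge e₁ (d.app k U ω) η +
      (-1 : ℤ) ^ k • Form.wedge e₂ ω (d.app l U η) := by
  subst e
  exact hd.leibniz k l U ω η

end

/-! ### From Lie algebroids to differential graded algebras. -/

theorem pullback_wedge {E L : Mod O} {k l : ℕ} {U : Opens X} (φ : E ⟶ L) (ω : Form L k U)
    (η : Form L l U) : (pullback φ).app (k + l) U (Form.wedge rfl ω η) =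
      Form.wedge rfl ((pullback φ).app k U ω) ((pullback φ).app l U η) :=
  Form.ext fun V hV _ =>
    (map_mul'_domCoprod (RingHom.id (O.sec V)) (homApp φ V)
      ((ω.eval V hV).compLinearMap (homApp φ V)) ((η.eval V hV).compLinearMap (homApp φ V))
      (ω.eval V hV) (η.eval V hV) (fun _ => rfl) (fun _ => rfl) _).symm

section

variable [CharZero K] {E L : Mod O}

theorem isDGA_ceOperator (hE : IsLocallyFreeOfFiniteRank E) (S : LieAlgebroidStr E) :
    IsDGA (ceOperator S) where
  sq_zero k U ω := by
    refine Form.eq_of_frames hE fun V hV n F => F.eval_injective ?_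
    exact ceDiff_ceDiff (S.bracket V) (S.bracket_self V) (anchorAt S.anchor V) (S.leibniz V)
      (F.basis V le_rfl) (S.anchor_bracket V) (S.jacobi V) (ω.eval V hV)
  leibniz k l U ω η := by
    refine Form.eq_of_frames hE fun V hV n F => F.eval_injective ?_
    refine (ceDiff_wedgeAlt (S.bracket V) (S.bracket_self V) (anchorAt S.anchor V) (S.leibniz V)
      (F.basis V le_rfl) rfl (by omega) (by omega) (ω.eval V hV) (η.eval V hV)).trans ?_
    change _ = (Form.wedge _ _ η + _).eval V hV
    rw [Form.add_eval, Form.zsmul_eval]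
    rfl

/-- Compatibility with the differentials is the naturality `map_ceFormula` of the
Chevalley–Eilenberg formula, applied over a fixed ring to the map that `φ` induces on sections. -/
theorem isDGAHom_pullback {S : LieAlgebroidStr E} {T : LieAlgebroidStr L} {φ : E ⟶ L}
    (h : IsLieAlgebroidHom S T φ) : IsDGAHom (ceOperator T) (ceOperator S) (pullback φ) where
  map_one U := rfl
  map_wedge k l U ω η := pullback_wedge φ ω η
  map_d k U ω := Form.ext fun V hV v =>
    (map_ceFormula (RingHom.id (O.sec V)) (homApp φ V) (S.bracket V) (T.bracket V)
      (anchorAt S.anchor V) (anchorAt T.anchor V) (h.map_bracket V)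
      (fun x z => by rw [← h.anchor_comp]; rfl) ((ω.eval V hV).compLinearMap (homApp φ V))
      (ω.eval V hV) (fun _ => rfl) v).symm

theorem factorsThroughAnchor_pullback {S : LieAlgebroidStr E} {T : LieAlgebroidStr L} {φ : E ⟶ L}
    (h : IsLieAlgebroidHom S T φ) : FactorsThroughAnchor T (ceOperator S) (pullback φ) :=
  fun U f => Form.ext fun V hV v => by
    refine (ceFormula_const (S.bracket V) (anchorAt S.anchor V) (O.res hV f) v).trans ?_
    rw [← h.anchor_comp]
    rfl

theorem isOmegaDGA_pullback (hE : IsLocallyFreeOfFiniteRank E) {S : LieAlgebroidStr E}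
    {T : LieAlgebroidStr L} {φ : E ⟶ L} (h : IsLieAlgebroidHom S T φ) :
    IsOmegaDGA T (ceOperator S) (pullback φ) :=
  ⟨isDGA_ceOperator hE S, isDGAHom_pullback h, factorsThroughAnchor_pullback h⟩

end

/-! ### Sections as functionals on 1-forms, and anchors as compatible families of derivations. -/

section

variable {E : Mod O} {U : Opens X}

/-- The coordinate forms of local frames separate sections. Forms over smaller open sets are
required as tests, since there may be too few 1-forms over `U` itself. -/
theorem Sec.ext_forms (hE : IsLocallyFreeOfFiniteRank E) {s t : Sec E U}
    (h : ∀ (V : Opens X) (hV : V ≤ U) (α : Form E 1 V),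
      α.toLin V le_rfl (Sec.res E hV s) = α.toLin V le_rfl (Sec.res E hV t)) : s = t := by
  refine Sec.eq_of_locally E fun x hx => ?_
  obtain ⟨V, hxV, n, ⟨F⟩⟩ := hE.exists_frame x
  refine ⟨V ⊓ U, inf_le_right, ⟨hxV, hx⟩, ((F.res inf_le_left).basis (V ⊓ U) le_rfl).ext_elem
    fun i => ?_⟩
  exact h (V ⊓ U) inf_le_right ((F.res inf_le_left).coordForm i)

theorem Form.toLin_res {V W : Opens X} (hV : V ≤ U) (h : W ≤ V) (α : Form E 1 U) (s : Sec E V) :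
    O.res h (α.toLin V hV s) = α.toLin W (h.trans hV) (Sec.res E h s) :=
  α.eval_res hV h _

/-- A locally free sheaf of finite rank is reflexive. -/
theorem exists_section (hE : IsLocallyFreeOfFiniteRank E)
    (θ : ∀ V : Opens X, V ≤ U → (Form E 1 V →ₗ[O.sec V] O.sec V))
    (hθ : ∀ (V W : Opens X) (hV : V ≤ U) (h : W ≤ V) (α : Form E 1 V),
      O.res h (θ V hV α) = θ W (h.trans hV) (Form.res h α)) :
    ∃ s : Sec E U, ∀ (V : Opens X) (hV : V ≤ U) (α : Form E 1 V),
      α.toLin V le_rfl (Sec.res E hV s) = θ V hV α := by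
  have hloc : ∀ x : U, ∃ V : Opens X, (x : X) ∈ V ∧ ∃ hV : V ≤ U, ∃ s : Sec E V,
      ∀ (W : Opens X) (hW : W ≤ V) (α : Form E 1 W),
        α.toLin W le_rfl (Sec.res E hW s) = θ W (hW.trans hV) α := by
    intro x
    obtain ⟨V', hxV, n, ⟨F'⟩⟩ := hE.exists_frame (x : X)
    let V := V' ⊓ U
    let F : Frame E V n := F'.res inf_le_left
    -- Locally the section is the combination of the frame whose coordinates are the values of `θ`
    -- on the coordinate forms.
    refine ⟨V, ⟨hxV, x.2⟩, inf_le_right,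
      ∑ i, θ V inf_le_right (F.coordForm i) • F.basis V le_rfl i, fun W hW α => ?_⟩
    rw [map_sum, map_sum]
    have h1 : α = ∑ i, α.toLin W le_rfl (F.basis W hW i) • Form.res hW (F.coordForm i) := by
      refine (Form.toDual_bijective (F.res hW)).1 (((F.res hW).basis W le_rfl).ext fun j => ?_)
      rw [map_sum, LinearMap.sum_apply, Finset.sum_eq_single j]
      · rw [map_smul, LinearMap.smul_apply]
        have : Form.toDual E W (Form.res hW (F.coordForm j)) ((F.res hW).basis W le_rfl j) = 1 := by
          change (F.basis W hW).coord j (F.basis W hW j) = 1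
          simp
        rw [this, smul_eq_mul, mul_one]
        rfl
      · intro i _ hij
        rw [map_smul, LinearMap.smul_apply]
        have : Form.toDual E W (Form.res hW (F.coordForm i)) ((F.res hW).basis W le_rfl j) = 0 := by
          change (F.basis W hW).coord i (F.basis W hW j) = 0
          simp [hij.symm]
        rw [this, smul_zero]
      · simp
    conv_rhs => rw [h1]
    rw [map_sum]
    refine Finset.sum_congr rfl fun i _ => ?_
    rw [LinearMap.map_smulₛₗ, map_smul, map_smul, F.res_basis, ← hθ V W, smul_eq_mul, smul_eq_mul,
      mul_comm]
    rfl
  choose V hxV hV s hs using hloc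
  -- The local sections agree on overlaps because they represent the same functional there.
  obtain ⟨t, ht⟩ := Sec.exists_gluing E V hV hxV s fun x y => Sec.ext_forms hE fun W hW α => by
    rw [Sec.res_res, Sec.res_res, hs, hs]
  refine ⟨t, fun W hW α => sec_eq_of_locally fun x hx => ?_⟩
  refine ⟨V ⟨x, hW hx⟩ ⊓ W, inf_le_right, ⟨hxV _, hx⟩, ?_⟩
  rw [Form.toLin_res, Sec.res_res, hθ, ← hs ⟨x, hW hx⟩ _ inf_le_left, ← ht, Sec.res_res]
  rfl

theorem Form.wedge_one_one_eval (e : 1 + 1 = 2) (α β : Form E 1 U) (V : Opens X) (hV : V ≤ U)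
    (x y : Sec E V) : (Form.wedge e α β).eval V hV ![x, y] =
      α.toLin V hV x * β.toLin V hV y - α.toLin V hV y * β.toLin V hV x := by
  have h : ∀ γ : Form E 1 U, γ.eval V hV = detForm fun _ => γ.toLin V hV := fun γ => by
    rw [detForm_one, Form.linForm_toLin]
  rw [Form.wedge_eval, h, h, wedgeAlt_detForm, detForm_apply, Matrix.det_fin_two]
  simp only [Matrix.of_apply]
  change α.toLin V hV x * β.toLin V hV y - β.toLin V hV x * α.toLin V hV y = _
  ring

/-- A section of the tangent sheaf over `U` is a family of derivations over all `V ⊆ U`. This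
expresses every member through `anchorAt`, so that `anchorAt` determines the anchor. -/
theorem homApp_toDer {a : E ⟶ tangentSheaf O} {V : Opens X} (h : V ≤ U) (D : Sec E U) :
    (toDer U (homApp a U D)).1 ⟨V, h⟩ = anchorAt a V (Sec.res E h D) := by
  have h2 : toDer V (homApp a V (Sec.res E h D)) = Der.res h (toDer U (homApp a U D)) := by
    rw [homApp_res]; rfl
  change _ = (toDer V (homApp a V (Sec.res E h D))).1 ⟨V, le_rfl⟩
  rw [h2]
  rfl

theorem anchor_ext {a a' : E ⟶ tangentSheaf O} (h : ∀ U D f, anchorAt a U D f = anchorAt a' U D f) :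
    a = a' := by
  refine hom_ext fun U D => ?_
  change toDer U (homApp a U D) = toDer U (homApp a' U D)
  refine Subtype.ext (funext fun V => ?_)
  refine (homApp_toDer V.2 D).trans (Eq.trans ?_ (homApp_toDer V.2 D).symm)
  exact Derivation.ext fun f => h _ _ f

section

variable (g : ∀ U : Opens X, Sec E U →ₗ[O.sec U] Derivation K (O.sec U) (O.sec U))
  (hg : ∀ {U V : Opens X} (h : V ≤ U) (D : Sec E U) (f : O.sec U),
    O.res h (g U D f) = g V (Sec.res E h D) (O.res h f))

/-- A compatible family of derivations, applied to a section. -/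
def derMk (U : Opens X) : Sec E U →ₗ[O.sec U] Der O U where
  toFun D := ⟨fun V => g V.1 (Sec.res E V.2 D), fun V W h f =>
    (hg h _ f).trans (by rw [Sec.res_res])⟩
  map_add' D D' := Subtype.ext (funext fun V =>
    (congrArg (g V.1) (map_add (Sec.res E V.2) D D')).trans (map_add (g V.1) _ _))
  map_smul' f D := Subtype.ext (funext fun V =>
    (congrArg (g V.1) ((Sec.res E V.2).map_smulₛₗ f D)).trans (map_smul (g V.1) _ _))

/-- Derivations as sections of the tangent sheaf. -/
def ofDer (U : Opens X) : Der O U →ₗ[O.sec U] Sec (tangentSheaf O) U where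
  toFun D := D
  map_add' _ _ := rfl
  map_smul' _ _ := rfl

theorem derMk_res {U V : Opens X} (h : V ≤ U) (D : Sec E U) :
    derMk g hg V (Sec.res E h D) = Der.res h (derMk g hg U D) :=
  Subtype.ext (funext fun W => congrArg (g W.1) (Sec.res_res E h W.2 D))

/-- The morphism into the tangent sheaf given by a compatible family of derivations. -/
def anchorMk : E ⟶ tangentSheaf O :=
  homMk (fun U => ofDer U ∘ₗ derMk g hg U) fun h D => derMk_res g hg h D

theorem anchorAt_anchorMk (U : Opens X) : anchorAt (anchorMk g hg) U = g U :=
  LinearMap.ext fun D => congrArg (g U) (Sec.res_self E D)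

end

end

/-! ### From a differential on forms to a Lie algebroid structure. -/

namespace FormOperator

variable {E : Mod O} {U V : Opens X} (d : FormOperator E)

theorem ofFun_smulK (r : K) (f : O.sec U) :
    (Form.ofFun (r • f) : Form E 0 U) = r • Form.ofFun f := by
  rw [← algebraMap_smul (O.sec U) r f, map_smul]
  rfl

variable (hd : IsDGA d) (hE : IsLocallyFreeOfFiniteRank E)

include hd hE in
theorem app_ofFun_mul (f g : O.sec U) : d.app 0 U (Form.ofFun (f * g)) =
    f • d.app 0 U (Form.ofFun g) + g • d.app 0 U (Form.ofFun f) := by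
  have h := hd.leibniz_cast (k := 0) (l := 0) rfl rfl rfl (Form.ofFun f) (Form.ofFun g)
  rw [Form.wedge_ofFun_left hE, Form.wedge_ofFun_left hE, Form.wedge_ofFun_right hE, pow_zero,
    one_smul, ← map_smul, smul_eq_mul] at h
  exact h.trans (add_comm _ _)

include hd hE in
theorem app_smul (f : O.sec U) (α : Form E 1 U) : d.app 1 U (f • α) =
    Form.wedge rfl (d.app 0 U (Form.ofFun f)) α + f • d.app 1 U α := by
  have h := hd.leibniz_cast (k := 0) (l := 1) rfl rfl rfl (Form.ofFun f) α
  rw [Form.wedge_ofFun_left hE, Form.wedge_ofFun_left hE, pow_zero, one_smul] at h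
  exact h

/-- The derivation of `O(U)` attached to a section `D` of `E` over `U`. -/
def der (U : Opens X) : Sec E U →ₗ[O.sec U] Derivation K (O.sec U) (O.sec U) where
  toFun D := Derivation.mk'
    { toFun := fun f => (d.app 0 U (Form.ofFun f)).toLin U le_rfl D
      map_add' := fun f g => by rw [map_add, map_add]; rfl
      map_smul' := fun r f => by
        rw [ofFun_smulK, map_smul]
        exact Form.smulK_eval _ _ _ _ }
    fun f g => by
      change (d.app 0 U (Form.ofFun (f * g))).toLin U le_rfl D = _
      rw [app_ofFun_mul d hd hE]
      rfl
  map_add' D D' := by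
    ext f : 1
    exact map_add ((d.app 0 U (Form.ofFun f)).toLin U le_rfl) D D'
  map_smul' g D := by
    ext f : 1
    exact map_smul ((d.app 0 U (Form.ofFun f)).toLin U le_rfl) g D

theorem der_apply (D : Sec E U) (f : O.sec U) :
    der d hd hE U D f = (d.app 0 U (Form.ofFun f)).toLin U le_rfl D := rfl

theorem der_res (h : V ≤ U) (D : Sec E U) (f : O.sec U) :
    O.res h (der d hd hE U D f) = der d hd hE V (Sec.res E h D) (O.res h f) := by
  rw [der_apply, der_apply, Form.toLin_res]
  have h1 : (Form.ofFun (O.res h f) : Form E 0 V) = Form.res h (Form.ofFun f) := rfl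
  rw [h1, d.app_res]
  rfl

/-- The anchor attached to a differential on the forms on `E`. -/
def anchorHom : E ⟶ tangentSheaf O :=
  anchorMk (der d hd hE) (der_res d hd hE)

theorem anchorAt_anchorHom : anchorAt (anchorHom d hd hE) U = der d hd hE U :=
  anchorAt_anchorMk _ _ U

/-- The value of a `1`-form on the bracket of two sections. -/
def bracketFunctional (D D' : Sec E U) : Form E 1 U →ₗ[O.sec U] O.sec U where
  -- The Chevalley–Eilenberg formula for `dα(D, D')`, solved for `α([D, D'])`.
  toFun α := der d hd hE U D (α.toLin U le_rfl D') - der d hd hE U D' (α.toLin U le_rfl D) -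
    (d.app 1 U α).eval U le_rfl ![D, D']
  map_add' α β := by
    have h : ∀ D, (α + β).toLin U le_rfl D = α.toLin U le_rfl D + β.toLin U le_rfl D := fun _ => rfl
    rw [h, h, map_add, map_add, map_add, Form.add_eval, AlternatingMap.add_apply]
    abel
  -- In `d(fα) = df ∧ α + f dα` the first term has the value `D(f) α(D') - D'(f) α(D)` at `(D, D')`,
  -- which cancels the derivatives of `f` coming from the first two terms of the functional.
  map_smul' f α := by
    have h : ∀ D, (f • α).toLin U le_rfl D = f • α.toLin U le_rfl D := fun _ => rfl
    rw [h, h, app_smul d hd hE, Form.add_eval, AlternatingMap.add_apply, Form.wedge_one_one_eval,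
      Form.smul_eval, AlternatingMap.smul_apply, smul_eq_mul, smul_eq_mul, Derivation.leibniz,
      Derivation.leibniz, der_apply d hd hE _ f, der_apply d hd hE _ f]
    have h2 : O.res (le_refl U) f = f := rfl
    simp only [smul_eq_mul, h2, RingHom.id_apply]
    ring

end FormOperator

theorem Sec.res_smul {E : Mod O} {U V : Opens X} (h : V ≤ U) (f : O.sec U) (s : Sec E U) :
    Sec.res E h (f • s) = O.res h f • Sec.res E h s :=
  (Sec.res E h).map_smulₛₗ f s

namespace FormOperator

variable {E : Mod O} {U V : Opens X} (d : FormOperator E) (hd : IsDGA d)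
  (hE : IsLocallyFreeOfFiniteRank E)

theorem bracketFunctional_apply (D D' : Sec E U) (α : Form E 1 U) :
    bracketFunctional d hd hE D D' α = der d hd hE U D (α.toLin U le_rfl D') -
      der d hd hE U D' (α.toLin U le_rfl D) - (d.app 1 U α).eval U le_rfl ![D, D'] := rfl

theorem bracketFunctional_res (h : V ≤ U) (D D' : Sec E U) (α : Form E 1 U) :
    O.res h (bracketFunctional d hd hE D D' α) =
      bracketFunctional d hd hE (Sec.res E h D) (Sec.res E h D') (Form.res h α) := by
  have h1 : ∀ D : Sec E U, O.res h (α.toLin U le_rfl D) =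
      (Form.res h α).toLin V le_rfl (Sec.res E h D) := fun D => Form.toLin_res le_rfl h α D
  have h2 : (fun i => Sec.res E h (![D, D'] i)) = ![Sec.res E h D, Sec.res E h D'] := by
    funext i; fin_cases i <;> rfl
  rw [bracketFunctional_apply, bracketFunctional_apply, map_sub, map_sub, der_res, der_res, h1, h1,
    Form.eval_res, h2, d.app_res]
  rfl

/-- Reflexivity of `E` represents the functional by a section. Prescribing its restrictions to all
`V ⊆ U` as well is what makes the bracket commute with restriction. -/
theorem exists_bracket (D D' : Sec E U) : ∃ s : Sec E U, ∀ (V : Opens X) (hV : V ≤ U)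
    (α : Form E 1 V), α.toLin V le_rfl (Sec.res E hV s) =
      bracketFunctional d hd hE (Sec.res E hV D) (Sec.res E hV D') α :=
  exists_section hE (fun V hV => bracketFunctional d hd hE (Sec.res E hV D) (Sec.res E hV D'))
    fun V W hV h α => by rw [bracketFunctional_res, Sec.res_res, Sec.res_res]

/-- The bracket of two sections attached to a differential on the forms on `E`. -/
def bracketSec (D D' : Sec E U) : Sec E U := (exists_bracket d hd hE D D').choose

theorem toLin_res_bracketSec (D D' : Sec E U) (V : Opens X) (hV : V ≤ U) (α : Form E 1 V) :
    α.toLin V le_rfl (Sec.res E hV (bracketSec d hd hE D D')) =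
      bracketFunctional d hd hE (Sec.res E hV D) (Sec.res E hV D') α :=
  (exists_bracket d hd hE D D').choose_spec V hV α

theorem toLin_bracketSec (D D' : Sec E U) (α : Form E 1 U) :
    α.toLin U le_rfl (bracketSec d hd hE D D') = bracketFunctional d hd hE D D' α := by
  have h := toLin_res_bracketSec d hd hE D D' U le_rfl α
  rwa [Sec.res_self, Sec.res_self, Sec.res_self] at h

theorem bracketSec_res (h : V ≤ U) (D D' : Sec E U) :
    Sec.res E h (bracketSec d hd hE D D') =
      bracketSec d hd hE (Sec.res E h D) (Sec.res E h D') :=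
  Sec.ext_forms hE fun W hW α => by
    rw [Sec.res_res, toLin_res_bracketSec, toLin_res_bracketSec, Sec.res_res, Sec.res_res]

theorem bracketSec_self (D : Sec E U) : bracketSec d hd hE D D = 0 :=
  Sec.ext_forms hE fun V hV α => by
    rw [toLin_res_bracketSec, bracketFunctional_apply, sub_self, map_zero, map_zero, zero_sub,
      ((d.app 1 V α).eval V le_rfl).map_eq_zero_of_eq _ (i := 0) (j := 1) rfl (by decide), neg_zero]

theorem bracketSec_swap (D D' : Sec E U) :
    bracketSec d hd hE D D' = - bracketSec d hd hE D' D :=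
  Sec.ext_forms hE fun V hV α => by
    rw [map_neg, map_neg, toLin_res_bracketSec, toLin_res_bracketSec, bracketFunctional_apply,
      bracketFunctional_apply, map_vecCons_swap]
    ring

theorem bracketSec_add_left (D₁ D₂ D' : Sec E U) : bracketSec d hd hE (D₁ + D₂) D' =
    bracketSec d hd hE D₁ D' + bracketSec d hd hE D₂ D' :=
  Sec.ext_forms hE fun V hV α => by
    simp only [map_add, toLin_res_bracketSec, bracketFunctional_apply, Derivation.add_apply,
      AlternatingMap.map_vecCons_add]
    ring

theorem bracketSec_smul_left (f : O.sec U) (D D' : Sec E U) : bracketSec d hd hE (f • D) D' =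
    f • bracketSec d hd hE D D' - der d hd hE U D' f • D :=
  Sec.ext_forms hE fun V hV α => by
    rw [map_sub, map_sub, toLin_res_bracketSec, Sec.res_smul, Sec.res_smul, Sec.res_smul, map_smul,
      map_smul, toLin_res_bracketSec, bracketFunctional_apply, bracketFunctional_apply, map_smul,
      map_smul, AlternatingMap.map_vecCons_smul, der_res, Derivation.smul_apply, smul_eq_mul,
      smul_eq_mul, smul_eq_mul, smul_eq_mul, smul_eq_mul, Derivation.leibniz, smul_eq_mul,
      smul_eq_mul]
    ring

theorem bracketSec_smulK_left (r : K) (D D' : Sec E U) : bracketSec d hd hE (r • D) D' =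
    r • bracketSec d hd hE D D' := by
  rw [← algebraMap_smul (O.sec U) r D, bracketSec_smul_left, Derivation.map_algebraMap, zero_smul,
    sub_zero, algebraMap_smul]

/-- The bracket attached to a differential on the forms on `E`. -/
def bracketₗ (U : Opens X) : Sec E U →ₗ[K] Sec E U →ₗ[K] Sec E U :=
  LinearMap.mk₂ K (bracketSec d hd hE) (bracketSec_add_left d hd hE)
    (bracketSec_smulK_left d hd hE)
    (fun D D₁ D₂ => by
      rw [bracketSec_swap, bracketSec_add_left, neg_add, ← bracketSec_swap, ← bracketSec_swap])
    fun r D D' => by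
      rw [bracketSec_swap, bracketSec_smulK_left, ← smul_neg, ← bracketSec_swap]

theorem bracketₗ_self (D : Sec E U) : bracketₗ d hd hE U D D = 0 := bracketSec_self d hd hE D

theorem bracketₗ_smul (D : Sec E U) (f : O.sec U) (D' : Sec E U) : bracketₗ d hd hE U D (f • D') =
    f • bracketₗ d hd hE U D D' + der d hd hE U D f • D' := by
  change bracketSec d hd hE _ _ = f • bracketSec d hd hE _ _ + _
  rw [bracketSec_swap, bracketSec_smul_left, bracketSec_swap d hd hE D D', smul_neg]
  abel

variable [CharZero K]

/-- Over an open set with a frame, the differential is given by the Chevalley–Eilenberg formula. -/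
theorem eval_app_eq_ceDiff {n : ℕ} (F : Frame E U n) (k : ℕ) (ω : Form E k U) :
    (d.app k U ω).eval U le_rfl = ceDiff (bracketₗ d hd hE U) (bracketₗ_self d hd hE)
      (der d hd hE U) (bracketₗ_smul d hd hE) (ω.eval U le_rfl) := by
  -- Both sides are antiderivations, and over a frame the functions and 1-forms generate. Agreement
  -- in degree 0 is the definition of the derivations, agreement on 1-forms the definition of the
  -- bracket.
  induction k with
  | zero =>
    obtain ⟨f, rfl⟩ := Form.exists_eq_ofFun ω
    rw [Form.ofFun_eval, ceDiff_const, Form.linForm_toLin]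
    rfl
  | succ k ih =>
    induction ω using Form.induction_succ F with
    | add ω η h h' => rw [map_add, Form.add_eval, Form.add_eval, h, h', ceDiff_add]
    | wedge α η =>
      have h1 : (d.app 1 U α).eval U le_rfl = ceDiff (bracketₗ d hd hE U) (bracketₗ_self d hd hE)
          (der d hd hE U) (bracketₗ_smul d hd hE) (α.eval U le_rfl) := by
        refine AlternatingMap.ext fun v => ?_
        have hv : v = ![v 0, v 1] := by ext i; fin_cases i <;> rfl
        rw [Form.linForm_toLin α, ceDiff_apply, ceFormula_linForm]
        have h2 : α.toLin U le_rfl (bracketₗ d hd hE U (v 0) (v 1)) = _ :=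
          toLin_bracketSec d hd hE (v 0) (v 1) α
        rw [h2, bracketFunctional_apply, ← hv, sub_sub_cancel]
      rw [hd.leibniz_cast _ (by omega) (by omega), Form.wedge_eval,
        ceDiff_wedgeAlt _ _ _ _ (F.basis U le_rfl) _ (by omega) (by omega), ← ih, ← h1,
        Form.add_eval, Form.zsmul_eval]
      rfl

/-- This is `d²f = 0`, evaluated at `(D, D')`. -/
theorem der_bracketₗ {n : ℕ} (F : Frame E U n) (D D' : Sec E U) :
    der d hd hE U (bracketₗ d hd hE U D D') = ⁅der d hd hE U D, der d hd hE U D'⁆ := by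
  refine Derivation.ext fun f => ?_
  have h : (d.app 1 U (d.app 0 U (Form.ofFun f))).eval U le_rfl ![D, D'] = 0 := by
    rw [hd.sq_zero]
    rfl
  rw [eval_app_eq_ceDiff d hd hE F, eval_app_eq_ceDiff d hd hE F, Form.ofFun_eval, ceDiff_const,
    ceDiff_apply, ceFormula_linForm] at h
  rw [Derivation.commutator_apply]
  exact (sub_eq_zero.1 h).symm

/-- The coordinates of the Jacobiator are, up to sign, the values of `d²` on the coordinate forms of
the frame. -/
theorem bracketₗ_jacobi {n : ℕ} (F : Frame E U n) (D₁ D₂ D₃ : Sec E U) :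
    bracketₗ d hd hE U D₁ (bracketₗ d hd hE U D₂ D₃) +
      bracketₗ d hd hE U D₂ (bracketₗ d hd hE U D₃ D₁) +
      bracketₗ d hd hE U D₃ (bracketₗ d hd hE U D₁ D₂) = 0 := by
  refine (F.basis U le_rfl).ext_elem fun i => ?_
  have h : (d.app 2 U (d.app 1 U (F.coordForm i))).eval U le_rfl ![D₁, D₂, D₃] = 0 := by
    rw [hd.sq_zero]
    rfl
  rw [eval_app_eq_ceDiff d hd hE F, eval_app_eq_ceDiff d hd hE F, Form.linForm_toLin,
    ceDiff_apply] at h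
  have h' := ceFormula_ceFormula_linForm (bracketₗ d hd hE U) (der d hd hE U)
    (bracketₗ_self d hd hE) (der_bracketₗ d hd hE F) ((F.coordForm i).toLin U le_rfl)
    (ceDiff (bracketₗ d hd hE U) (bracketₗ_self d hd hE) (der d hd hE U) (bracketₗ_smul d hd hE)
      (linForm ((F.coordForm i).toLin U le_rfl))) (ceDiff_apply _ _ _ _ _) D₁ D₂ D₃
  rw [map_zero]
  exact neg_eq_zero.1 (h'.symm.trans h)

/-- The Lie algebroid structure attached to a differential on the forms on `E`. -/
def lieAlgebroidStr : LieAlgebroidStr E where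
  bracket := bracketₗ d hd hE
  bracket_self _ := bracketₗ_self d hd hE
  bracket_res h := bracketSec_res d hd hE h
  anchor := anchorHom d hd hE
  leibniz U := by
    rw [anchorAt_anchorHom]
    exact bracketₗ_smul d hd hE
  anchor_bracket U D D' := by
    rw [anchorAt_anchorHom]
    -- The identity is known over open sets with a frame. Brackets and derivations commute with
    -- restriction, so it may be checked there; the same holds for the Jacobi identity below.
    refine Derivation.ext fun f => sec_eq_of_locally fun x hx => ?_
    obtain ⟨V, hxV, n, ⟨F⟩⟩ := hE.exists_frame x
    refine ⟨V ⊓ U, inf_le_right, ⟨hxV, hx⟩, ?_⟩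
    have h : Sec.res E (inf_le_right : V ⊓ U ≤ U) (bracketₗ d hd hE U D D') =
      bracketₗ d hd hE (V ⊓ U) (Sec.res E inf_le_right D) (Sec.res E inf_le_right D') :=
        bracketSec_res d hd hE inf_le_right D D'
    rw [der_res, h, der_bracketₗ d hd hE (F.res inf_le_left), Derivation.commutator_apply,
      Derivation.commutator_apply, map_sub, der_res, der_res, der_res, der_res]
  jacobi U D₁ D₂ D₃ := by
    refine Sec.eq_of_locally E fun x hx => ?_
    obtain ⟨V, hxV, n, ⟨F⟩⟩ := hE.exists_frame x
    refine ⟨V ⊓ U, inf_le_right, ⟨hxV, hx⟩, ?_⟩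
    have h : ∀ D D', Sec.res E (inf_le_right : V ⊓ U ≤ U) (bracketₗ d hd hE U D D') =
      bracketₗ d hd hE (V ⊓ U) (Sec.res E inf_le_right D) (Sec.res E inf_le_right D') :=
        bracketSec_res d hd hE inf_le_right
    rw [map_add, map_add, h, h, h, h, h, h, map_zero]
    exact bracketₗ_jacobi d hd hE (F.res inf_le_left) _ _ _

theorem eq_ceOperator : d = ceOperator (lieAlgebroidStr d hd hE) := by
  refine FormOperator.ext (funext fun k => funext fun U => LinearMap.ext fun ω => ?_)
  refine Form.eq_of_frames hE fun V hV n F => F.eval_injective ?_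
  change (Form.res hV (d.app k U ω)).eval V le_rfl = _
  rw [← d.app_res, eval_app_eq_ceDiff d hd hE F]
  refine AlternatingMap.ext fun v => ?_
  change ceFormula _ _ _ v = ceFormula _ (anchorAt (anchorHom d hd hE) V) _ v
  rw [anchorAt_anchorHom]
  rfl

end FormOperator

/-! ### From a multiplicative map of forms to a morphism of modules. -/

namespace FormHom

variable {E L : Mod O} {U V : Opens X} (ψ : FormHom L E) (hL : IsLocallyFreeOfFiniteRank L)

-- For a section `D` of `E`, `β ↦ ψ₁(β)(D)` is a compatible family of functionals on the 1-forms of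
-- `L`, and reflexivity of `L` represents it by a section.
include hL in
theorem exists_transpose (D : Sec E U) : ∃ s : Sec L U, ∀ (V : Opens X) (hV : V ≤ U)
    (β : Form L 1 V), β.toLin V le_rfl (Sec.res L hV s) =
      (ψ.app 1 V β).toLin V le_rfl (Sec.res E hV D) := by
  refine exists_section hL (fun V hV =>
    LinearMap.applyₗ (Sec.res E hV D) ∘ₗ Form.toDual E V ∘ₗ ψ.app 1 V) fun V W hV h β => ?_
  refine (Form.toLin_res le_rfl h (ψ.app 1 V β) (Sec.res E hV D)).trans ?_
  rw [Sec.res_res]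
  change _ = (ψ.app 1 W (Form.res h β)).toLin W le_rfl _
  rw [ψ.app_res]
  rfl

/-- The image of a section under the transpose of the degree `1` part of `ψ`. -/
def transposeSec (D : Sec E U) : Sec L U := (exists_transpose ψ hL D).choose

theorem toLin_res_transposeSec (D : Sec E U) (V : Opens X) (hV : V ≤ U) (β : Form L 1 V) :
    β.toLin V le_rfl (Sec.res L hV (transposeSec ψ hL D)) =
      (ψ.app 1 V β).toLin V le_rfl (Sec.res E hV D) :=
  (exists_transpose ψ hL D).choose_spec V hV β

/-- The morphism `E ⟶ L` whose dual is the degree `1` part of `ψ`. -/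
def transpose : E ⟶ L :=
  homMk (fun U =>
    { toFun := transposeSec ψ hL
      map_add' := fun D D' => Sec.ext_forms hL fun V hV β => by
        simp only [map_add, toLin_res_transposeSec]
      map_smul' := fun f D => Sec.ext_forms hL fun V hV β => by
        rw [RingHom.id_apply, Sec.res_smul, map_smul, toLin_res_transposeSec,
          toLin_res_transposeSec, Sec.res_smul, map_smul] })
    fun h D => Sec.ext_forms hL fun V hV β => by
      change _ = β.toLin V le_rfl (Sec.res L hV (Sec.res L h (transposeSec ψ hL D)))
      rw [Sec.res_res, toLin_res_transposeSec]
      refine (toLin_res_transposeSec ψ hL _ V hV β).trans ?_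
      rw [Sec.res_res]

theorem toLin_transpose (D : Sec E U) (β : Form L 1 U) :
    β.toLin U le_rfl (homApp (transpose ψ hL) U D) = (ψ.app 1 U β).toLin U le_rfl D := by
  have h := toLin_res_transposeSec ψ hL D U le_rfl β
  rwa [Sec.res_self, Sec.res_self] at h

theorem app_one_eq (β : Form L 1 U) : ψ.app 1 U β = (pullback (transpose ψ hL)).app 1 U β := by
  refine Form.ext fun V hV v => ?_
  have hv : v = fun _ => v 0 := by funext i; rw [Subsingleton.elim i 0]
  have h := toLin_transpose ψ hL (v 0) (Form.res hV β)
  rw [ψ.app_res] at h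
  rw [hv]
  exact h.symm

/-- Both maps are multiplicative and agree on 1-forms by the choice of the transpose; over a frame
of `L` this settles all positive degrees once degree 0 is known. -/
theorem eq_pullback (hone : ∀ U, ψ.app 0 U (Form.ofFun 1) = Form.ofFun 1)
    (hwedge : ∀ (k l : ℕ) (U : Opens X) (ω : Form L k U) (η : Form L l U),
      ψ.app (k + l) U (Form.wedge rfl ω η) = Form.wedge rfl (ψ.app k U ω) (ψ.app l U η)) :
    ψ = pullback (transpose ψ hL) := by
  have hw : ∀ {k l m : ℕ} (e : k + l = m) (U : Opens X) (ω : Form L k U) (η : Form L l U),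
      ψ.app m U (Form.wedge e ω η) = Form.wedge e (ψ.app k U ω) (ψ.app l U η) := by
    rintro k l m rfl
    exact hwedge k l
  have hw' : ∀ {k l m : ℕ} (e : k + l = m) (U : Opens X) (ω : Form L k U) (η : Form L l U),
      (pullback (transpose ψ hL)).app m U (Form.wedge e ω η) =
        Form.wedge e ((pullback (transpose ψ hL)).app k U ω)
          ((pullback (transpose ψ hL)).app l U η) := by
    rintro k l m rfl U ω η
    exact pullback_wedge _ ω η
  refine FormHom.ext (funext fun k => funext fun U => LinearMap.ext fun ω => ?_)
  refine Form.eq_of_frames hL fun V hV n F => ?_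
  rw [← ψ.app_res, ← (pullback (transpose ψ hL)).app_res]
  generalize Form.res hV ω = θ
  clear ω
  induction k with
  | zero =>
    obtain ⟨f, rfl⟩ := Form.exists_eq_ofFun θ
    -- A function is a multiple of `1`, so degree 0 is fixed by linearity and preservation of the
    -- unit.
    have h : ∀ E : Mod O, (Form.ofFun f : Form E 0 V) = f • Form.ofFun 1 := fun E => by
      rw [← map_smul, smul_eq_mul, mul_one]
    rw [h, map_smul, map_smul, hone]
    rfl
  | succ k ih =>
    induction θ using Form.induction_succ F with
    | add ω η h h' => rw [map_add, map_add, h, h']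
    | wedge α η => rw [hw, hw', ih, app_one_eq ψ hL]

end FormHom

/-! ### Compatibility with brackets and anchors, and the equivalence. -/

/-- The factorization of `d` in degree 0 says that `φ` commutes with the anchors. Given this, `φ^*
d_L β = d_E φ^* β` for 1-forms `β` of `L` says that `β` takes the same value on `φ[D, D']` and `[φ
D, φ D']`, and such `β` separate sections of `L`. -/
theorem isLieAlgebroidHom_of_isOmegaDGA [CharZero K] {E L : Mod O}
    (hL : IsLocallyFreeOfFiniteRank L) {S : LieAlgebroidStr E} {T : LieAlgebroidStr L} {φ : E ⟶ L}
    (h : IsOmegaDGA T (ceOperator S) (pullback φ)) : IsLieAlgebroidHom S T φ := by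
  have ha : φ ≫ T.anchor = S.anchor := anchor_ext fun U D f => by
    have h1 := congrArg (fun ω : Form E 1 U => ω.toLin U le_rfl D) (h.factors U f)
    have h2 : anchorAt S.anchor U D f = ((ceOperator S).app 0 U (Form.ofFun f)).toLin U le_rfl D :=
      (ceFormula_const (S.bracket U) (anchorAt S.anchor U) f fun _ => D).symm
    exact (h2.trans h1).symm
  have ha' : ∀ U D, anchorAt S.anchor U D = anchorAt T.anchor U (homApp φ U D) := fun U D => by
    rw [← ha]; rfl
  refine ⟨fun U D D' => Sec.ext_forms hL fun V hV β => ?_, ha⟩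
  rw [← homApp_res, S.bracket_res hV, T.bracket_res hV, ← homApp_res, ← homApp_res]
  generalize Sec.res E hV D = x
  generalize Sec.res E hV D' = y
  have h1 := congrArg (fun ω : Form E 2 V => ω.eval V le_rfl ![x, y])
    (h.isDGAHom.map_d 1 V β)
  have h2 : ((ceOperator S).app 1 V ((pullback φ).app 1 V β)).eval V le_rfl ![x, y] =
      ceFormula (S.bracket V) (anchorAt S.anchor V)
        (linForm (β.toLin V le_rfl ∘ₗ homApp φ V)) ![x, y] := by
    have h5 : linForm (β.toLin V le_rfl ∘ₗ homApp φ V) =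
        ((pullback φ).app 1 V β).eval V le_rfl := by
      refine AlternatingMap.ext fun v => ?_
      exact congrArg (β.eval V le_rfl)
        (funext fun i => congrArg (fun j => homApp φ V (v j)) (Subsingleton.elim 0 i))
    rw [h5]
    rfl
  have h3 : ((pullback φ).app 2 V ((ceOperator T).app 1 V β)).eval V le_rfl ![x, y] =
      ceFormula (T.bracket V) (anchorAt T.anchor V) (linForm (β.toLin V le_rfl))
        (fun i => homApp φ V (![x, y] i)) := by
    rw [← Form.linForm_toLin]
    rfl
  have h4 := h3.symm.trans (h1.trans h2)
  -- The anchor terms on the two sides coincide by `ha'`, so only the values of `β` on the two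
  -- brackets are left to compare.
  rw [ceFormula_linForm, ceFormula_linForm] at h4
  simp only [Matrix.cons_val_zero, Matrix.cons_val_one, LinearMap.comp_apply, ha'] at h4
  exact (sub_right_injective h4).symm

theorem isOmegaDGA_iff [CharZero K] {E L : Mod O} (hE : IsLocallyFreeOfFiniteRank E)
    (hL : IsLocallyFreeOfFiniteRank L) (T : LieAlgebroidStr L) (d : FormOperator E)
    (ψ : FormHom L E) : IsOmegaDGA T d ψ ↔ ∃ (S : LieAlgebroidStr E) (φ : E ⟶ L),
      IsLieAlgebroidHom S T φ ∧ d = ceOperator S ∧ ψ = pullback φ := by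
  constructor
  · intro h
    have hd := d.eq_ceOperator h.isDGA hE
    have hψ := ψ.eq_pullback hL h.isDGAHom.map_one h.isDGAHom.map_wedge
    refine ⟨d.lieAlgebroidStr h.isDGA hE, ψ.transpose hL, isLieAlgebroidHom_of_isOmegaDGA hL ?_,
      hd, hψ⟩
    rwa [← hd, ← hψ]
  · rintro ⟨S, φ, h, rfl, rfl⟩
    exact isOmegaDGA_pullback hE h

end TopRingedSpace

end
theorem mainTheorem2 {K : Type u} [Field K] [CharZero K] [TopologicalSpace K] {X : TopCat.{u}}
    (O : TopRingedSpace K X) (L : TopRingedSpace.Mod O) (T : TopRingedSpace.LieAlgebroidStr L)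
    (hL : TopRingedSpace.IsLocallyFreeOfFiniteRank L) (E : TopRingedSpace.Mod O)
    (hE : TopRingedSpace.IsLocallyFreeOfFiniteRank E) :
    TopRingedSpace.FormsAreExteriorAlgebra E ∧
    ((∃ S : TopRingedSpace.LieAlgebroidStr E, TopRingedSpace.IsLieAlgebroidOver S T) ↔
      ∃ (d : TopRingedSpace.FormOperator E) (ψ : TopRingedSpace.FormHom L E),
        TopRingedSpace.IsOmegaDGA T d ψ) ∧
    (∀ (d : TopRingedSpace.FormOperator E) (ψ : TopRingedSpace.FormHom L E),
      TopRingedSpace.IsOmegaDGA T d ψ ↔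
        ∃ (S : TopRingedSpace.LieAlgebroidStr E) (φ : E ⟶ L),
          TopRingedSpace.IsLieAlgebroidHom S T φ ∧
            d = TopRingedSpace.ceOperator S ∧ ψ = TopRingedSpace.pullback φ) := by
  refine ⟨TopRingedSpace.formsAreExteriorAlgebra hE, ⟨?_, ?_⟩,
    TopRingedSpace.isOmegaDGA_iff hE hL T⟩
  · rintro ⟨S, φ, h⟩
    exact ⟨_, _, TopRingedSpace.isOmegaDGA_pullback hE h⟩
  · rintro ⟨d, ψ, h⟩
    obtain ⟨S, φ, h, -⟩ := (TopRingedSpace.isOmegaDGA_iff hE hL T d ψ).1 h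
    exact ⟨S, φ, h⟩
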